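/- Fix $K\ge 1$ and numbers of factors $r_1,\dots,r_K\ge 1$. Consider sample sizes $T,p_1,\dots,p_K$ with $\min\{T,p_1,\dots,p_K\}\to\infty$ along an arbitrary sequence, with no restriction on the relative rates (all objects below may depend on the position in that sequence unless stated otherwise), and put $p=p_1\cdots p_K$, $p_{-k}=p/p_k$, $$L=\min\{p,\;T p_{-1},\dots,T p_{-K}\}.$$ For a tensor $\mathcal F\in\mathbb R^{r_1\times\cdots\times r_K}$ and matrices $A_k$ with $r_k$ columns, $\mathcal F\times_{k=1}^K A_k$ is the tensor with entries $\sum_{j_1,\dots,j_K}\mathcal F_{j_1\dots j_K}\prod_k (A_k)_{i_k j_k}$; $\mathrm{mat}_k(\mathcal F)$ is the mode-$k$ unfolding; $\|\cdot\|_F$ is the Frobenius norm. Let $\mathcal A_k\subset\mathbb R^{r_k}$ and $\mathcal F^\ast\subset\mathbb R^{r_1\times\cdots\times r_K}$ be fixed closed sets. The parameter space $\Theta$ is the set of all $\theta=(A_1,\dots,A_K,\mathcal F_1,\dots,\mathcal F_T)$ such that $A_k\in\mathbb R^{p_k\times r_k}$ has all its rows in $\mathcal A_k$ and $p_k^{-1}A_k^\top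 A_k=I_{r_k}$, every $\mathcal F_t$ is in $\mathcal F^\ast$, and, for every $k$, $T^{-1}\sum_{t=1}^T \mathrm{mat}_k(\mathcal F_t)\mathrm{mat}_k(\mathcal F_t)^\top$ is diagonal with positive non-increasing diagonal entries. Let the data be $\mathcal X_t=\mathcal F_{0t}\times_{k=1}^K A_{0k}+\mathcal E_t$, $1\le t\le T$, and assume: 1. $\theta_0=(A_{01},\dots,A_{0K},\mathcal F_{01},\dots,\mathcal F_{0T})\in\Theta$ is nonrandom; $\|A_{0k}\|_F=c_k p_k^{1/2}$ for constants $0<c_k<\infty$ (not depending on the sample sizes); and, for every $k$, $T^{-1}\sum_{t=1}^T \mathrm{mat}_k(\mathcal F_{0t})\mathrm{mat}_k(\mathcal F_{0t})^\top\to\Sigma_{0k}$, where $\Sigma_{0k}$ is a fixed diagonal matrix with positive, strictly decreasing diagonal entries. 2. For each sample size, the entries $e_{t,i_1,\dots,i_K}$ of $\mathcal E_1,\dots,\mathcal E_T$ are mutually independent across $t$ and $i_1,\dots,i_K$. 3. $\mathbb E\,e_{t,i_1,\dots,i_K}=0$; there is a $\nu>0$, not depending on the sample sizes or on the indices, such that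 $\mathbb E|e_{t,i_1,\dots,i_K}|^{2d}\le \frac{(2d)!}{2^d d!}\nu^{2d}$ for all $d=1,2,\dots$; and $\|\mathcal E_t\|_F>0$ almost surely for all $t$. Let $\widehat\theta=(\widehat A_1,\dots,\widehat A_K,\widehat{\mathcal F}_1,\dots,\widehat{\mathcal F}_T)$ be any least-squares estimator, i.e. almost surely a minimiser of $T^{-1}\sum_{t=1}^T\|\mathcal X_t-\mathcal F_t\times_{k=1}^K A_k\|_F^2$ over $\theta\in\Theta$, and let $\widehat S_k=\mathrm{sgn}(A_{0k}^\top\widehat A_k/p_k)$ be the $r_k\times r_k$ diagonal matrix whose diagonal entries are the signs of the diagonal entries of $A_{0k}^\top\widehat A_k/p_k$. Then, for all $1\le k\le K$, $$\frac1{p_k}\big\|\widehat A_k-A_{0k}\widehat S_k\big\|_F^2=O_P\!\left(\frac1L\right)\qquad\text{and}\qquad \frac1T\sum_{t=1}^T\big\|\widehat{\mathcal F}_t-\mathcal F_{0t}\times_{k=1}^K\widehat S_k\big\|_F^2=O_P\!\left(\frac1L\right).$$ -/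

import Mathlib

open MeasureTheory ProbabilityTheory Filter Topology

namespace TensorFactor

noncomputable section

/-- Real tensors of order `K` and size `p 1 × ⋯ × p K`. -/
abbrev Tensor {K : ℕ} (p : Fin K → ℕ) : Type := (∀ k, Fin (p k)) → ℝ

/-- Squared Frobenius norm of a tensor. -/
def Tensor.frobSq {K : ℕ} {p : Fin K → ℕ} (X : Tensor p) : ℝ := ∑ i, X i ^ 2

/-- Squared Frobenius norm of a matrix. -/
def matFrobSq {m n : ℕ} (A : Matrix (Fin m) (Fin n) ℝ) : ℝ := ∑ i, ∑ j, A i j ^ 2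

/-- The successive mode products `F ×₁ A₁ ×₂ ⋯ ×_K A_K`, entrywise. -/
def tucker {K : ℕ} {r p : Fin K → ℕ} (F : Tensor r)
    (A : ∀ k, Matrix (Fin (p k)) (Fin (r k)) ℝ) : Tensor p :=
  fun i => ∑ j : (∀ k, Fin (r k)), F j * ∏ k, A k (i k) (j k)

/-- Mode-`k` unfolding. The columns, which are the mode-`k` fibres, are indexed by the tuples of
the remaining indices. -/
def unfold {K : ℕ} {r : Fin K → ℕ} (k : Fin K) (F : Tensor r) :
    Matrix (Fin (r k)) (∀ j : {j : Fin K // j ≠ k}, Fin (r j)) ℝ :=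
  Matrix.of fun a b => F ((Equiv.piSplitAt k fun j => Fin (r j)).symm (a, b))

/-- `T⁻¹ ∑ₜ mat_k(F_t) mat_k(F_t)ᵀ`. -/
def factorCov {K T : ℕ} {r : Fin K → ℕ} (F : Fin T → Tensor r) (k : Fin K) :
    Matrix (Fin (r k)) (Fin (r k)) ℝ :=
  (1 / (T : ℝ)) • ∑ t, unfold k (F t) * (unfold k (F t)).transpose

/-- A parameter value: the `K` loading matrices and the `T` factor tensors. -/
structure Param {K : ℕ} (r p : Fin K → ℕ) (T : ℕ) where
  loading : ∀ k, Matrix (Fin (p k)) (Fin (r k)) ℝ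
  factor : Fin T → Tensor r

/-- The common components `S_t = F_t ×₁ A₁ ×₂ ⋯ ×_K A_K`. -/
def Param.signal {K : ℕ} {r p : Fin K → ℕ} {T : ℕ} (θ : Param r p T) (t : Fin T) : Tensor p :=
  tucker (θ.factor t) θ.loading

/-- The parameter space determined by the sets `𝒜 k` (for the rows of the loading matrices)
and `ℱ` (for the factor tensors). -/
def paramSpace {K : ℕ} {r : Fin K → ℕ} (𝒜 : ∀ k, Set (Fin (r k) → ℝ)) (ℱ : Set (Tensor r))
    (p : Fin K → ℕ) (T : ℕ) : Set (Param r p T) :=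
  {θ | (∀ k i, θ.loading k i ∈ 𝒜 k) ∧
    (∀ k, (1 / (p k : ℝ)) • ((θ.loading k).transpose * θ.loading k) = 1) ∧
    (∀ t, θ.factor t ∈ ℱ) ∧
    (∀ k, (factorCov θ.factor k).IsDiag ∧ (∀ j, 0 < factorCov θ.factor k j j) ∧
      Antitone fun j => factorCov θ.factor k j j)}

/-- The least-squares criterion `T⁻¹ ∑ₜ ‖X_t - F_t ×₁ A₁ ⋯ ×_K A_K‖_F²`. -/
def lsLoss {K : ℕ} {r p : Fin K → ℕ} {T : ℕ} (X : Fin T → Tensor p) (θ : Param r p T) : ℝ :=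
  (1 / (T : ℝ)) * ∑ t, Tensor.frobSq (X t - θ.signal t)

/-- `θ` minimises the least-squares criterion for the data `X` over `Θ`. -/
def IsLeastSquares {K : ℕ} {r p : Fin K → ℕ} {T : ℕ} (Θ : Set (Param r p T))
    (X : Fin T → Tensor p) (θ : Param r p T) : Prop :=
  θ ∈ Θ ∧ ∀ θ' ∈ Θ, lsLoss X θ ≤ lsLoss X θ'

/-- `sgn(A₀ᵀ A / p)`: the diagonal matrix of the signs of the diagonal entries of `A₀ᵀ A / p`. -/
def signMatrix {p r : ℕ} (A₀ A : Matrix (Fin p) (Fin r) ℝ) : Matrix (Fin r) (Fin r) ℝ :=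
  Matrix.diagonal fun j => Real.sign ((A₀.transpose * A) j j / (p : ℝ))

/-- `p_{-k}`, the product of the sizes of all the modes but `k`. -/
def sizeExcept {K : ℕ} (p : Fin K → ℕ) (k : Fin K) : ℕ := ∏ j ∈ Finset.univ.erase k, p j

/-- `L = min {p, T p_{-1}, …, T p_{-K}}`. -/
def rateL {K : ℕ} [NeZero K] (p : Fin K → ℕ) (T : ℕ) : ℕ :=
  min (∏ k, p k) (Finset.univ.inf' Finset.univ_nonempty fun k => T * sizeExcept p k)

/-- `Y n = O_P(a n)` as `n → ∞`. -/
def IsBigOP {Ω : Type*} [MeasurableSpace Ω] (μ : Measure Ω) (Y : ℕ → Ω → ℝ) (a : ℕ → ℝ) : Prop :=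
  ∀ ε : ℝ, 0 < ε → ∃ C : ℝ, 0 < C ∧
    ∀ᶠ n in atTop, μ {ω | C * |a n| < |Y n ω|} ≤ ENNReal.ofReal ε

end

end TensorFactor

open TensorFactor

/-!
Write `Δ` for the difference of the fitted and the true signal and `E` for the errors. Since the
true parameter is admissible, least squares gives `‖Δ‖² ≤ 2 ⟨E, Δ⟩`. Along mode `k` the tensor `Δ`
lives on the span of the columns of the fitted and the true loadings, of dimension at most `2 r_k`,
so in orthonormal bases of these spans `⟨E, Δ⟩` is a sum of boundedly many values of the multilinear
form with coefficients `E`, whence `‖Δ‖` is at most a constant times the norm of that form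
(`sum_frobSq_signal_sub_le`). A multilinear form is bounded by its maximum over a product of nets of
the balls of radius `2`; there are at most `5 ^ (T + ∑ p_k)` points, at each of which the form is
sub-Gaussian, so its norm is `O_P(√(T + ∑ p_k))` (`measure_errForm_unbounded_le`). As
`(T + ∑ p_k) / (T p) ≤ (K + 1) / L`, the normalised error of the signal is `O_P(1 / L)`.

The rest is deterministic. After scaling, the loadings have orthonormal columns, hence the second
moment matrix of the signal along mode `k` is `U_k Λ_k U_kᵀ` with `Λ_k` the second moment matrix of
the factors (`factorCov_tucker`). The limits of the true `Λ_k` have distinct positive eigenvalues,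
so the true `Λ_k` eventually have gaps bounded below, and Weyl's inequality with a `sin Θ` argument
(`one_sub_inner_sq_le`) shows that the cosine `c` between corresponding columns satisfies
`1 - c² = O(δ)`, where `δ` is the normalised error of the signal. This gives the loadings up to
sign. The factors follow because mode products with orthonormal loadings are isometric
(`sum_frobSq_factor_sub_le`).
-/

namespace TensorFactor

open scoped Matrix

/-! ### Kronecker products and the mode products -/

/-- The Kronecker product of a family of matrices, with rows and columns indexed by tuples. -/
def kron {ι : Type*} [Fintype ι] {m n : ι → Type*} (A : ∀ k, Matrix (m k) (n k) ℝ) :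
    Matrix (∀ k, m k) (∀ k, n k) ℝ :=
  Matrix.of fun i j => ∏ k, A k (i k) (j k)

section Kron

variable {ι : Type*} [Fintype ι] {l m n : ι → Type*}

lemma kron_apply (A : ∀ k, Matrix (m k) (n k) ℝ) (i : ∀ k, m k) (j : ∀ k, n k) :
    kron A i j = ∏ k, A k (i k) (j k) := rfl

lemma kron_mul [DecidableEq ι] [∀ k, Fintype (m k)] (A : ∀ k, Matrix (l k) (m k) ℝ)
    (B : ∀ k, Matrix (m k) (n k) ℝ) :
    kron A * kron B = kron fun k => A k * B k := by
  ext i j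
  simp only [kron_apply, Matrix.mul_apply, Finset.prod_univ_sum, Fintype.piFinset_univ,
    Finset.prod_mul_distrib]

lemma kron_transpose (A : ∀ k, Matrix (m k) (n k) ℝ) :
    (kron A)ᵀ = kron fun k => (A k)ᵀ := rfl

lemma kron_one [∀ k, DecidableEq (m k)] [DecidableEq (∀ k, m k)] :
    kron (fun k => (1 : Matrix (m k) (m k) ℝ)) = 1 := by
  ext i j
  rw [kron_apply, Matrix.one_apply]
  split_ifs with h
  · subst h
    simp
  · obtain ⟨k, hk⟩ := Function.ne_iff.mp h
    exact Finset.prod_eq_zero (Finset.mem_univ k) (Matrix.one_apply_ne hk)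

lemma kron_transpose_mul_self [DecidableEq ι] [∀ k, Fintype (m k)] [∀ k, DecidableEq (n k)]
    [DecidableEq (∀ k, n k)] {Q : ∀ k, Matrix (m k) (n k) ℝ} (hQ : ∀ k, (Q k)ᵀ * Q k = 1) :
    (kron Q)ᵀ * kron Q = 1 := by
  rw [kron_transpose, kron_mul]
  simp only [hQ]
  exact kron_one

lemma kron_smul (c : ι → ℝ) (A : ∀ k, Matrix (m k) (n k) ℝ) :
    (kron fun k => c k • A k) = (∏ k, c k) • kron A := by
  ext i j
  simp [kron_apply, Finset.prod_mul_distrib]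

/-- The entrywise inner product of two Kronecker products is the product of the entrywise
inner products. -/
lemma sum_kron_mul_kron [DecidableEq ι] [∀ k, Fintype (m k)] [∀ k, Fintype (n k)]
    (A B : ∀ k, Matrix (m k) (n k) ℝ) :
    ∑ i, ∑ j, kron A i j * kron B i j = ∏ k, ∑ i, ∑ j, A k i j * B k i j := by
  simp only [kron_apply, ← Finset.prod_mul_distrib]
  simp only [Finset.prod_univ_sum, Fintype.piFinset_univ]

end Kron

section Tucker

variable {K : ℕ} {r p : Fin K → ℕ}

lemma tucker_eq_mulVec (F : Tensor r) (A : ∀ k, Matrix (Fin (p k)) (Fin (r k)) ℝ) :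
    tucker F A = kron A *ᵥ F := by
  ext i
  simp [tucker, Matrix.mulVec, dotProduct, kron_apply, mul_comm]

lemma frobSq_eq_dotProduct (X : Tensor p) : Tensor.frobSq X = X ⬝ᵥ X := by
  simp [Tensor.frobSq, dotProduct, sq]

lemma frobSq_nonneg (X : Tensor p) : 0 ≤ Tensor.frobSq X :=
  Finset.sum_nonneg fun _ _ => sq_nonneg _

lemma frobSq_smul (c : ℝ) (X : Tensor p) : Tensor.frobSq (c • X) = c ^ 2 * Tensor.frobSq X := by
  simp [Tensor.frobSq, mul_pow, Finset.mul_sum]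

lemma frobSq_add_le (X Y : Tensor p) :
    Tensor.frobSq (X + Y) ≤ 2 * Tensor.frobSq X + 2 * Tensor.frobSq Y := by
  simp only [Tensor.frobSq, Finset.mul_sum, ← Finset.sum_add_distrib]
  refine Finset.sum_le_sum fun i _ => ?_
  simp only [Pi.add_apply]
  nlinarith [sq_nonneg (X i - Y i)]

lemma tucker_tucker {q : Fin K → ℕ} (F : Tensor r) (R : ∀ k, Matrix (Fin (q k)) (Fin (r k)) ℝ)
    (Q : ∀ k, Matrix (Fin (p k)) (Fin (q k)) ℝ) :
    tucker (tucker F R) Q = tucker F fun k => Q k * R k := by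
  simp only [tucker_eq_mulVec, Matrix.mulVec_mulVec, kron_mul]

lemma tucker_sub (F G : Tensor r) (A : ∀ k, Matrix (Fin (p k)) (Fin (r k)) ℝ) :
    tucker (F - G) A = tucker F A - tucker G A := by
  simp only [tucker_eq_mulVec, Matrix.mulVec_sub]

lemma tucker_smul (c : Fin K → ℝ) (F : Tensor r) (A : ∀ k, Matrix (Fin (p k)) (Fin (r k)) ℝ) :
    tucker F (fun k => c k • A k) = (∏ k, c k) • tucker F A := by
  simp only [tucker_eq_mulVec, kron_smul, Matrix.smul_mulVec]

/-- Mode products with matrices that have orthonormal columns are isometric. -/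
lemma frobSq_tucker {Q : ∀ k, Matrix (Fin (p k)) (Fin (r k)) ℝ} (hQ : ∀ k, (Q k)ᵀ * Q k = 1)
    (G : Tensor r) : Tensor.frobSq (tucker G Q) = Tensor.frobSq G := by
  rw [frobSq_eq_dotProduct, frobSq_eq_dotProduct, tucker_eq_mulVec, Matrix.dotProduct_mulVec,
    Matrix.vecMul_mulVec, kron_transpose_mul_self hQ, Matrix.vecMul_one]

lemma unfold_apply (k : Fin K) (F : Tensor r) (a : Fin (r k))
    (b : ∀ j : {j : Fin K // j ≠ k}, Fin (r j)) :
    unfold k F a b = F ((Equiv.piSplitAt k fun j => Fin (r j)).symm (a, b)) := rfl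

lemma frobSq_eq_sum_unfold (k : Fin K) (F : Tensor r) :
    Tensor.frobSq F = ∑ a, ∑ b, unfold k F a b ^ 2 := by
  rw [Tensor.frobSq, ← Fintype.sum_prod_type',
    ← (Equiv.piSplitAt k fun j => Fin (r j)).symm.sum_comp]
  rfl

lemma unfold_sub (k : Fin K) (F G : Tensor r) : unfold k (F - G) = unfold k F - unfold k G := rfl

lemma kron_piSplitAt_symm (A : ∀ k, Matrix (Fin (p k)) (Fin (r k)) ℝ) (k : Fin K)
    (a : Fin (p k)) (b : ∀ j : {j : Fin K // j ≠ k}, Fin (p j))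
    (a' : Fin (r k)) (b' : ∀ j : {j : Fin K // j ≠ k}, Fin (r j)) :
    kron A ((Equiv.piSplitAt k fun j => Fin (p j)).symm (a, b))
      ((Equiv.piSplitAt k fun j => Fin (r j)).symm (a', b')) =
      A k a a' * kron (fun j : {j : Fin K // j ≠ k} => A j) b b' := by
  rw [kron_apply, Fintype.prod_eq_mul_prod_subtype_ne _ k, kron_apply]
  congr 1
  · simp [Equiv.piSplitAt]
  · refine Finset.prod_congr rfl fun j _ => ?_
    simp [Equiv.piSplitAt, j.2]

/-- The mode-`k` unfolding of `F ×₁ A₁ ⋯ ×_K A_K` is `A_k mat_k(F) (⨂_{j ≠ k} A_j)ᵀ`. -/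
lemma unfold_tucker (k : Fin K) (F : Tensor r) (A : ∀ k, Matrix (Fin (p k)) (Fin (r k)) ℝ) :
    unfold k (tucker F A) =
      A k * unfold k F * (kron fun j : {j : Fin K // j ≠ k} => A j)ᵀ := by
  ext a b
  rw [unfold_apply, tucker_eq_mulVec, Matrix.mulVec, dotProduct,
    ← (Equiv.piSplitAt k fun j => Fin (r j)).symm.sum_comp, Fintype.sum_prod_type]
  simp only [Matrix.mul_apply, Matrix.transpose_apply, Finset.sum_mul]
  rw [Finset.sum_comm]
  refine Finset.sum_congr rfl fun b' _ => Finset.sum_congr rfl fun a' _ => ?_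
  rw [kron_piSplitAt_symm, unfold_apply]
  ring

/-- If the loadings have orthonormal columns, then the second moment matrix of the signal along
mode `k` is the conjugate of that of the factors by the mode-`k` loadings. -/
lemma factorCov_tucker {T : ℕ} {U : ∀ k, Matrix (Fin (p k)) (Fin (r k)) ℝ}
    (hU : ∀ k, (U k)ᵀ * U k = 1) (F : Fin T → Tensor r) (k : Fin K) :
    factorCov (fun t => tucker (F t) U) k = U k * factorCov F k * (U k)ᵀ := by
  have hW : (kron fun j : {j : Fin K // j ≠ k} => U j)ᵀ *
      (kron fun j : {j : Fin K // j ≠ k} => U j) = 1 := kron_transpose_mul_self fun j => hU j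
  simp only [factorCov, unfold_tucker, Matrix.transpose_mul, Matrix.transpose_transpose,
    Matrix.mul_smul, Matrix.smul_mul, Matrix.mul_sum, Matrix.sum_mul]
  congr 1
  refine Finset.sum_congr rfl fun t _ => ?_
  simp only [Matrix.mul_assoc]
  rw [← Matrix.mul_assoc _ (kron _), hW, Matrix.one_mul]

lemma trace_factorCov {T : ℕ} (F : Fin T → Tensor r) (k : Fin K) :
    (factorCov F k).trace = (1 / (T : ℝ)) * ∑ t, Tensor.frobSq (F t) := by
  simp only [factorCov, Matrix.trace_smul, Matrix.trace_sum, smul_eq_mul]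
  congr 1
  refine Finset.sum_congr rfl fun t _ => ?_
  rw [frobSq_eq_sum_unfold k]
  simp [Matrix.trace, Matrix.mul_apply, sq]

/-- Replacing the loadings changes the mode products by at most the Frobenius norm of the
difference of the Kronecker products. -/
lemma frobSq_tucker_sub_le (F : Tensor r) (A B : ∀ k, Matrix (Fin (p k)) (Fin (r k)) ℝ) :
    Tensor.frobSq (tucker F A - tucker F B) ≤
      Tensor.frobSq F * (∏ k, matFrobSq (A k) + ∏ k, matFrobSq (B k) -
        2 * ∏ k, ∑ i, ∑ j, A k i j * B k i j) := by
  have h : ∏ k, matFrobSq (A k) + ∏ k, matFrobSq (B k) - 2 * ∏ k, ∑ i, ∑ j, A k i j * B k i j =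
      ∑ i, ∑ j, (kron A i j - kron B i j) ^ 2 := by
    simp only [matFrobSq, sq, ← sum_kron_mul_kron, Finset.mul_sum, ← Finset.sum_add_distrib,
      ← Finset.sum_sub_distrib]
    refine Finset.sum_congr rfl fun i _ => Finset.sum_congr rfl fun j _ => ?_
    ring
  rw [h, tucker_eq_mulVec, tucker_eq_mulVec, ← Matrix.sub_mulVec, Tensor.frobSq, Tensor.frobSq,
    Finset.mul_sum]
  refine Finset.sum_le_sum fun i _ => ?_
  rw [mul_comm]
  exact Finset.sum_mul_sq_le_sq_mul_sq _ _ _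

end Tucker

/-! ### Perturbation of eigenvalues and eigenvectors -/

section Perturbation

variable {H : Type*} [NormedAddCommGroup H] [InnerProductSpace ℝ H] {r : ℕ}

/-- The operator `v ↦ ∑ λ_j ⟨u_j, v⟩ u_j`; for orthonormal `u` this is its spectral
decomposition. -/
def specMap (u : Fin r → H) (lam : Fin r → ℝ) (v : H) : H :=
  ∑ j, (lam j * inner ℝ (u j) v) • u j

lemma inner_specMap (u : Fin r → H) (lam : Fin r → ℝ) (v w : H) :
    inner ℝ w (specMap u lam v) = ∑ j, lam j * inner ℝ (u j) v * inner ℝ w (u j) := by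
  simp [specMap, inner_sum, inner_smul_right]

/-- Weyl's inequality for the nonzero eigenvalues of two operators of the same rank: by a dimension
count there is a unit vector in the span of `û_1, …, û_j` orthogonal to `u_1, …, u_{j-1}`, and the
two quadratic forms are compared there. -/
lemma weyl_le {u u' : Fin r → H} (hu : Orthonormal ℝ u) (hu' : Orthonormal ℝ u')
    {lam lam' : Fin r → ℝ} (hlam : Antitone lam) (hlam' : Antitone lam') (hpos : ∀ j, 0 ≤ lam j)
    {ε : ℝ} (hε : ∀ v, ‖specMap u' lam' v - specMap u lam v‖ ≤ ε * ‖v‖) (j : Fin r) :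
    lam' j ≤ lam j + ε := by
  classical
  let φ : (Set.Iic j → ℝ) →ₗ[ℝ] (Set.Iio j → ℝ) :=
    Matrix.toLin' (Matrix.of fun l i => inner ℝ (u l) (u' i))
  have hker : LinearMap.ker φ ≠ ⊥ := by
    apply LinearMap.ker_ne_bot_of_finrank_lt
    simp [Module.finrank_fintype_fun_eq_card]
  obtain ⟨a, ha, ha0⟩ := Submodule.exists_mem_ne_zero_of_ne_bot hker
  let b : Fin r → ℝ := fun i => if h : i ≤ j then a ⟨i, h⟩ else 0
  have hb0 : ∀ i, j < i → b i = 0 := fun i hi => dif_neg (not_le.mpr hi)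
  let v : H := ∑ i, b i • u' i
  have hv' : ∀ i, inner ℝ (u' i) v = b i := fun i => by
    simpa using hu'.inner_right_fintype b i
  have hvn : ‖v‖ ^ 2 = ∑ i, b i ^ 2 := by
    rw [← real_inner_self_eq_norm_sq]
    simp only [v, sum_inner, real_inner_smul_left]
    exact Finset.sum_congr rfl fun i _ => by rw [sq]; congr 1; exact hv' i
  have hvpos : 0 < ‖v‖ ^ 2 := by
    rw [hvn]
    obtain ⟨i, hi⟩ := Function.ne_iff.mp ha0
    refine Finset.sum_pos' (fun _ _ => sq_nonneg _) ⟨i, Finset.mem_univ _, ?_⟩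
    have : b i = a i := dif_pos i.2
    rw [this]
    exact sq_pos_of_ne_zero hi
  have hvu : ∀ l, l < j → inner ℝ (u l) v = 0 := fun l hl => by
    have h := congrFun (LinearMap.mem_ker.mp ha) ⟨l, hl⟩
    simp only [φ, Matrix.toLin'_apply, Matrix.mulVec, dotProduct, Matrix.of_apply,
      Pi.zero_apply] at h
    simp only [v, inner_sum, inner_smul_right]
    have hsum := Finset.sum_subtype (F := inferInstance) (Finset.univ.filter (· ≤ j))
      (p := (· ∈ Set.Iic j)) (by simp)
      fun i => b i * inner ℝ (u l) (u' i)
    rw [← h, ← Finset.sum_filter_of_ne (p := (· ≤ j)), hsum]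
    · refine Finset.sum_congr rfl fun i _ => ?_
      rw [mul_comm, show b i = a i from dif_pos i.2]
    · intro i _ hi
      by_contra hij
      exact hi (by simp [hb0 i (not_le.mp hij)])
  have h1 : lam' j * ‖v‖ ^ 2 ≤ inner ℝ v (specMap u' lam' v) := by
    rw [inner_specMap, hvn, Finset.mul_sum]
    refine Finset.sum_le_sum fun i _ => ?_
    rw [real_inner_comm (u' i) v, hv', mul_assoc, ← sq]
    rcases le_or_gt i j with hi | hi
    · exact mul_le_mul_of_nonneg_right (hlam' hi) (sq_nonneg _)
    · simp [hb0 i hi]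
  have h2 : inner ℝ v (specMap u lam v) ≤ lam j * ‖v‖ ^ 2 := by
    rw [inner_specMap]
    calc _ ≤ ∑ i, lam j * inner ℝ (u i) v ^ 2 := by
          refine Finset.sum_le_sum fun i _ => ?_
          rw [real_inner_comm (u i) v, mul_assoc, ← sq]
          rcases lt_or_ge i j with hi | hi
          · simp [hvu i hi]
          · exact mul_le_mul_of_nonneg_right (hlam hi) (sq_nonneg _)
      _ ≤ lam j * ‖v‖ ^ 2 := by
          rw [← Finset.mul_sum]
          refine mul_le_mul_of_nonneg_left ?_ (hpos j)
          simpa using hu.sum_inner_products_le (s := Finset.univ) (x := v)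
  have h3 : inner ℝ v (specMap u' lam' v - specMap u lam v) ≤ ε * ‖v‖ ^ 2 :=
    (real_inner_le_norm _ _).trans (by nlinarith [hε v, norm_nonneg v])
  rw [inner_sub_right] at h3
  nlinarith

/-- The `sin Θ` theorem for a single eigenvector. The bound is trivial for `ε > g / 2`; for
`ε ≤ g / 2`, Weyl's inequality separates `λ̂_j` from the `λ_i` with `i ≠ j` and from `0` by `g / 2`,
and `‖M̂ û_j - M û_j‖²`, for `M`, `M̂` the two operators, is expanded in the orthonormal system
`u`. -/
lemma one_sub_inner_sq_le {u u' : Fin r → H} (hu : Orthonormal ℝ u) (hu' : Orthonormal ℝ u')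
    {lam lam' : Fin r → ℝ} (hlam : Antitone lam) (hlam' : Antitone lam') (hpos : ∀ j, 0 ≤ lam j)
    (hpos' : ∀ j, 0 ≤ lam' j) {ε g : ℝ} (hg : 0 < g) (hgap0 : ∀ j, g ≤ lam j)
    (hgap : ∀ i j, i ≠ j → g ≤ |lam i - lam j|)
    (hε : ∀ v, ‖specMap u' lam' v - specMap u lam v‖ ≤ ε * ‖v‖) (j : Fin r) :
    1 - inner ℝ (u j) (u' j) ^ 2 ≤ 4 * ε ^ 2 / g ^ 2 := by
  have hε' : ∀ v, ‖specMap u lam v - specMap u' lam' v‖ ≤ ε * ‖v‖ := fun v => by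
    rw [norm_sub_rev]
    exact hε v
  have hnorm : ‖u' j‖ = 1 := hu'.1 j
  have hε0 : 0 ≤ ε := by simpa [hnorm] using (norm_nonneg _).trans (hε (u' j))
  rw [le_div_iff₀ (by positivity)]
  rcases lt_or_ge (g / 2) ε with h | h
  · nlinarith [sq_nonneg (inner ℝ (u j) (u' j)),
      mul_nonneg (sq_nonneg (inner ℝ (u j) (u' j))) (sq_nonneg g)]
  have hw1 := weyl_le hu hu' hlam hlam' hpos hε j
  have hw2 := weyl_le hu' hu hlam' hlam hpos' hε' j
  set c : Fin r → ℝ := fun i => inner ℝ (u i) (u' j) with hc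
  have hself : specMap u' lam' (u' j) = lam' j • u' j := by
    classical
    simp [specMap, orthonormal_iff_ite.mp hu']
  -- Pythagoras: `c i` are the coordinates of `û_j` in `u`, and the last term is the part of `û_j`
  -- orthogonal to `u`
  have hexp : ‖specMap u' lam' (u' j) - specMap u lam (u' j)‖ ^ 2 =
      ∑ i, c i ^ 2 * (lam' j - lam i) ^ 2 + lam' j ^ 2 * (1 - ∑ i, c i ^ 2) := by
    have hMM : ‖specMap u lam (u' j)‖ ^ 2 = ∑ i, (lam i * c i) ^ 2 := by
      rw [← real_inner_self_eq_norm_sq, inner_specMap]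
      refine Finset.sum_congr rfl fun i _ => ?_
      have : inner ℝ (specMap u lam (u' j)) (u i) = lam i * c i := by
        rw [real_inner_comm]
        exact hu.inner_right_fintype (fun i => lam i * c i) i
      rw [this]
      ring
    have hcross : inner ℝ (u' j) (specMap u lam (u' j)) = ∑ i, lam i * c i ^ 2 := by
      rw [inner_specMap]
      refine Finset.sum_congr rfl fun i _ => ?_
      rw [real_inner_comm (u i) (u' j)]
      simp only [hc]
      ring
    rw [norm_sub_sq_real, hMM, hself, real_inner_smul_left, hcross, norm_smul, hnorm, mul_sub,
      Finset.mul_sum, Finset.mul_sum, Finset.mul_sum, mul_one, mul_one, Real.norm_eq_abs, sq_abs,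
      add_sub, add_comm _ (lam' j ^ 2), add_sub_assoc, ← Finset.sum_sub_distrib, sub_add,
      ← Finset.sum_sub_distrib, sub_eq_add_neg, ← Finset.sum_neg_distrib]
    congr 1
    refine Finset.sum_congr rfl fun i _ => ?_
    ring
  have hbess : ∑ i, c i ^ 2 ≤ 1 := by
    have := hu.sum_inner_products_le (s := Finset.univ) (x := u' j)
    simpa [hnorm, hc] using this
  have hsep : (g / 2) ^ 2 * (1 - c j ^ 2) ≤
      ∑ i, c i ^ 2 * (lam' j - lam i) ^ 2 + lam' j ^ 2 * (1 - ∑ i, c i ^ 2) := by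
    have h1 : (g / 2) ^ 2 * (∑ i, c i ^ 2 - c j ^ 2) ≤ ∑ i, c i ^ 2 * (lam' j - lam i) ^ 2 := by
      rw [← Finset.add_sum_erase _ _ (Finset.mem_univ j), add_sub_cancel_left,
        ← Finset.add_sum_erase _ (fun i => c i ^ 2 * (lam' j - lam i) ^ 2) (Finset.mem_univ j),
        Finset.mul_sum]
      refine le_add_of_nonneg_of_le (by positivity) (Finset.sum_le_sum fun i hi => ?_)
      rw [mul_comm]
      refine mul_le_mul_of_nonneg_left ?_ (sq_nonneg _)
      rw [← sq_abs (lam' j - lam i)]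
      refine pow_le_pow_left₀ (by positivity) ?_ 2
      have h2 := hgap j i (Finset.ne_of_mem_erase hi).symm
      have h3 := abs_sub_le (lam j) (lam' j) (lam i)
      have h4 : |lam j - lam' j| ≤ ε := abs_le.mpr ⟨by linarith, by linarith⟩
      linarith
    have h2 : (g / 2) ^ 2 * (1 - ∑ i, c i ^ 2) ≤ lam' j ^ 2 * (1 - ∑ i, c i ^ 2) := by
      refine mul_le_mul_of_nonneg_right (pow_le_pow_left₀ (by positivity) ?_ 2) (by linarith)
      linarith [hgap0 j]
    linarith
  have hb := hε (u' j)
  rw [hnorm, mul_one] at hb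
  have := pow_le_pow_left₀ (norm_nonneg _) hb 2
  rw [hexp] at this
  change (1 - c j ^ 2) * g ^ 2 ≤ _
  linarith

/-- With `s` the sign of `⟨u, v⟩`, the distance of the unit vectors `v` and `s u` is controlled by
the sine of their angle. This includes `⟨u, v⟩ = 0`, where `s = 0`. -/
lemma one_sub_two_mul_abs_add_sign_sq_le {c : ℝ} (hc : |c| ≤ 1) :
    1 - 2 * |c| + Real.sign c ^ 2 ≤ 2 * (1 - c ^ 2) := by
  rcases eq_or_ne c 0 with rfl | h
  · simp
  · have : Real.sign c ^ 2 = 1 := by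
      rcases Real.sign_apply_eq_of_ne_zero c h with h | h <;> simp [h]
    rw [this, ← sq_abs c]
    nlinarith [abs_nonneg c]

end Perturbation

/-! ### Sub-Gaussian errors -/

section SubGaussian

lemma exp_le_add_cosh_two_mul (x : ℝ) : Real.exp x ≤ x + Real.cosh (2 * x) := by
  have hx := Real.add_one_le_exp (-x)
  have hy := Real.exp_pos x
  have hz := Real.exp_pos (-x)
  have hyz : Real.exp x * Real.exp (-x) = 1 := by rw [← Real.exp_add]; simp
  have hc : Real.cosh (2 * x) = (Real.exp x ^ 2 + Real.exp (-x) ^ 2) / 2 := by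
    rw [Real.cosh_eq, ← Real.exp_nat_mul, ← Real.exp_nat_mul]
    congr 3
    push_cast
    ring
  rw [hc]
  set y := Real.exp x
  set z := Real.exp (-x)
  -- with `s = y + z ≥ 2`, the difference of the sides is at least `s (s - 2) / 2`
  have hs : 2 ≤ y + z := by nlinarith [sq_nonneg (y - z)]
  nlinarith [mul_nonneg (by linarith : 0 ≤ y + z) (by linarith : 0 ≤ y + z - 2)]

variable {Ω : Type*} [MeasurableSpace Ω] {μ : Measure Ω} [IsProbabilityMeasure μ]

/-- If the even moments of `X` are at most those of a centred Gaussian variable, then so is the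
expectation of `cosh (a X)`. -/
lemma integrable_cosh_and_integral_le {X : Ω → ℝ} (hX : Measurable X) {ν : ℝ}
    (hmom : ∀ d : ℕ, 1 ≤ d → Integrable (fun ω => |X ω| ^ (2 * d)) μ ∧
      ∫ ω, |X ω| ^ (2 * d) ∂μ ≤
        (Nat.factorial (2 * d) : ℝ) / (2 ^ d * (Nat.factorial d : ℝ)) * ν ^ (2 * d)) (a : ℝ) :
    Integrable (fun ω => Real.cosh (a * X ω)) μ ∧
      ∫ ω, Real.cosh (a * X ω) ∂μ ≤ Real.exp (a ^ 2 * ν ^ 2 / 2) := by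
  have hterm : ∀ (d : ℕ) (x : ℝ), (a * x) ^ (2 * d) / (2 * d).factorial =
      a ^ (2 * d) / (2 * d).factorial * |x| ^ (2 * d) := fun d x => by
    rw [mul_pow, (even_two_mul d).pow_abs]
    ring
  have hcoef : ∀ d : ℕ, 0 ≤ a ^ (2 * d) / (2 * d).factorial := fun d =>
    div_nonneg ((even_two_mul d).pow_nonneg a) (by positivity)
  have hmeas : Measurable fun ω => Real.cosh (a * X ω) :=
    Real.continuous_cosh.measurable.comp (hX.const_mul a)
  have hint : ∀ d : ℕ, ∫⁻ ω, ENNReal.ofReal ((a * X ω) ^ (2 * d) / (2 * d).factorial) ∂μ ≤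
      ENNReal.ofReal ((a ^ 2 * ν ^ 2 / 2) ^ d / d.factorial) := fun d => by
    rcases Nat.eq_zero_or_pos d with rfl | hd
    · simp
    obtain ⟨h1, h2⟩ := hmom d hd
    simp only [hterm]
    rw [← ofReal_integral_eq_lintegral_ofReal (h1.const_mul _)
      (ae_of_all _ fun ω => mul_nonneg (hcoef d) (by positivity)), integral_const_mul]
    refine ENNReal.ofReal_le_ofReal ((mul_le_mul_of_nonneg_left h2 (hcoef d)).trans_eq ?_)
    have : ((2 * d).factorial : ℝ) ≠ 0 := by positivity
    have : (d.factorial : ℝ) ≠ 0 := by positivity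
    rw [div_pow, mul_pow, ← pow_mul, ← pow_mul]
    field_simp
  have hle : ∫⁻ ω, ENNReal.ofReal (Real.cosh (a * X ω)) ∂μ ≤
      ENNReal.ofReal (Real.exp (a ^ 2 * ν ^ 2 / 2)) := by
    have h1 : ∀ ω, ENNReal.ofReal (Real.cosh (a * X ω)) =
        ∑' d : ℕ, ENNReal.ofReal ((a * X ω) ^ (2 * d) / (2 * d).factorial) := fun ω => by
      rw [Real.cosh_eq_tsum, ENNReal.ofReal_tsum_of_nonneg _ (Real.hasSum_cosh _).summable]
      intro d
      rw [hterm]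
      exact mul_nonneg (hcoef d) (by positivity)
    simp only [h1]
    rw [lintegral_tsum fun d => by fun_prop]
    refine (ENNReal.tsum_le_tsum hint).trans_eq ?_
    rw [Real.exp_eq_exp_ℝ, NormedSpace.exp_eq_tsum_div,
      ENNReal.ofReal_tsum_of_nonneg (fun d => by positivity) (Real.summable_pow_div_factorial _)]
  have hI : Integrable (fun ω => Real.cosh (a * X ω)) μ := by
    refine ⟨hmeas.aestronglyMeasurable, ?_⟩
    rw [hasFiniteIntegral_iff_ofReal (ae_of_all _ fun ω => (Real.cosh_pos _).le)]
    exact hle.trans_lt ENNReal.ofReal_lt_top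
  refine ⟨hI, ?_⟩
  rw [← ofReal_integral_eq_lintegral_ofReal hI (ae_of_all _ fun ω => (Real.cosh_pos _).le)] at hle
  exact (ENNReal.ofReal_le_ofReal_iff (Real.exp_pos _).le).mp hle

/-- A centred variable whose even moments are at most those of `N(0, ν²)` is sub-Gaussian. -/
lemma hasSubgaussianMGF_of_even_moments {X : Ω → ℝ} (hX : Measurable X) {ν : ℝ}
    (hmean : ∫ ω, X ω ∂μ = 0)
    (hmom : ∀ d : ℕ, 1 ≤ d → Integrable (fun ω => |X ω| ^ (2 * d)) μ ∧
      ∫ ω, |X ω| ^ (2 * d) ∂μ ≤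
        (Nat.factorial (2 * d) : ℝ) / (2 ^ d * (Nat.factorial d : ℝ)) * ν ^ (2 * d)) :
    HasSubgaussianMGF X (4 * Real.toNNReal (ν ^ 2)) μ := by
  have hX1 : Integrable X μ := by
    refine ((integrable_const (1 : ℝ)).add (hmom 1 le_rfl).1).mono' hX.aestronglyMeasurable
      (ae_of_all _ fun ω => ?_)
    simp only [Pi.add_apply, Real.norm_eq_abs, mul_one]
    nlinarith [sq_nonneg (|X ω| - 1), abs_nonneg (X ω)]
  have hbound : ∀ t ω, Real.exp (t * X ω) ≤ t * X ω + Real.cosh (2 * t * X ω) := fun t ω => by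
    rw [mul_assoc]
    exact exp_le_add_cosh_two_mul _
  have hint : ∀ t, Integrable (fun ω => t * X ω + Real.cosh (2 * t * X ω)) μ := fun t =>
    (hX1.const_mul t).add (integrable_cosh_and_integral_le hX hmom (2 * t)).1
  have hexp : ∀ t, Integrable (fun ω => Real.exp (t * X ω)) μ := fun t =>
    (hint t).mono' (by fun_prop) (ae_of_all _ fun ω => by
      rw [Real.norm_eq_abs, Real.abs_exp]
      exact hbound t ω)
  refine ⟨hexp, fun t => ?_⟩
  calc mgf X μ t ≤ ∫ ω, (t * X ω + Real.cosh (2 * t * X ω)) ∂μ :=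
        integral_mono (hexp t) (hint t) (hbound t)
    _ = ∫ ω, Real.cosh (2 * t * X ω) ∂μ := by
        rw [integral_add (hX1.const_mul t) (integrable_cosh_and_integral_le hX hmom (2 * t)).1,
          integral_const_mul, hmean, mul_zero, zero_add]
    _ ≤ Real.exp ((2 * t) ^ 2 * ν ^ 2 / 2) := (integrable_cosh_and_integral_le hX hmom (2 * t)).2
    _ = _ := by
        congr 1
        push_cast
        rw [Real.coe_toNNReal _ (sq_nonneg ν)]
        ring

/-- A two-sided tail bound for weighted sums of independent sub-Gaussian variables. -/
lemma measure_lt_abs_weighted_sum_le {ι : Type*} [Fintype ι] {X : ι → Ω → ℝ}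
    (hindep : iIndepFun X μ) {c : NNReal} (hX : ∀ i, HasSubgaussianMGF (X i) c μ) {w : ι → ℝ}
    {W : NNReal} (hw : ∑ i, w i ^ 2 ≤ W) {s : ℝ} (hs : 0 ≤ s) :
    μ {ω | s < |∑ i, w i * X i ω|} ≤
      ENNReal.ofReal (2 * Real.exp (-s ^ 2 / (2 * (W * c)))) := by
  have h0 : HasSubgaussianMGF (fun ω => ∑ i, w i * X i ω) (W * c) μ := by
    have h := HasSubgaussianMGF.sum_of_iIndepFun (s := Finset.univ)
      (hindep.comp (fun i x => w i * x) fun i => measurable_const_mul (w i))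
      (c := fun i => Real.toNNReal (w i ^ 2) * c) fun i _ => by
        rw [Real.toNNReal_of_nonneg (sq_nonneg (w i))]
        exact (hX i).const_mul (w i)
    refine ⟨h.integrable_exp_mul, fun t => (h.mgf_le t).trans (Real.exp_le_exp.mpr ?_)⟩
    have hle : ((∑ i, Real.toNNReal (w i ^ 2) * c : NNReal) : ℝ) ≤
        ((W * c : NNReal) : ℝ) := by
      rw [NNReal.coe_sum, NNReal.coe_mul]
      calc _ = (∑ i, w i ^ 2) * (c : ℝ) := by
            rw [Finset.sum_mul]
            refine Finset.sum_congr rfl fun i _ => ?_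
            rw [NNReal.coe_mul, Real.coe_toNNReal _ (sq_nonneg _)]
        _ ≤ _ := mul_le_mul_of_nonneg_right hw c.2
    exact div_le_div_of_nonneg_right (mul_le_mul_of_nonneg_right hle (sq_nonneg t)) zero_le_two
  have h1 : ∀ Y : Ω → ℝ, HasSubgaussianMGF Y (W * c) μ →
      μ {ω | s ≤ Y ω} ≤ ENNReal.ofReal (Real.exp (-s ^ 2 / (2 * (W * c)))) := fun Y hY => by
    rw [← ofReal_measureReal]
    exact ENNReal.ofReal_le_ofReal (by simpa using hY.measure_ge_le hs)
  have hsub : {ω | s < |∑ i, w i * X i ω|} ⊆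
      {ω | s ≤ ∑ i, w i * X i ω} ∪ {ω | s ≤ (-fun ω => ∑ i, w i * X i ω) ω} := by
    intro ω hω
    rcases lt_abs.mp (show s < |∑ i, w i * X i ω| from hω) with h | h
    · exact Or.inl h.le
    · exact Or.inr h.le
  refine (measure_mono hsub).trans ((measure_union_le _ _).trans ?_)
  rw [two_mul, ENNReal.ofReal_add (Real.exp_pos _).le (Real.exp_pos _).le]
  exact add_le_add (h1 _ h0) (h1 _ h0.neg)

end SubGaussian

/-! ### Discretisation of multilinear forms -/

section Net

/-- A finite-dimensional space has a `1`-net of the ball of radius `2`, contained in that ball,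
with at most `5 ^ d` points. -/
lemma exists_finset_net (d : ℕ) :
    ∃ N : Finset (EuclideanSpace ℝ (Fin d)), N.card ≤ 5 ^ d ∧ (∀ v ∈ N, ‖v‖ ≤ 2) ∧
      ∀ x, ‖x‖ ≤ 2 → ∃ v ∈ N, ‖x - v‖ < 1 := by
  classical
  -- a separated subset of the ball of maximal cardinality is a net; its size is bounded by volume
  let P : ℕ → Prop := fun m => ∃ N : Finset (EuclideanSpace ℝ (Fin d)), N.card = m ∧
    (∀ v ∈ N, ‖v‖ ≤ 2) ∧ ∀ v ∈ N, ∀ w ∈ N, v ≠ w → 1 ≤ ‖v - w‖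
  have hP : ∀ m, P m → m ≤ 5 ^ d := by
    rintro m ⟨N, rfl, h1, h2⟩
    simpa using Besicovitch.card_le_of_separated N h1 h2
  have hP0 : P 0 := ⟨∅, by simp⟩
  obtain ⟨N, hN, h1, h2⟩ : P (Nat.findGreatest P (5 ^ d)) :=
    Nat.findGreatest_spec (Nat.zero_le _) hP0
  refine ⟨N, hN ▸ Nat.findGreatest_le _, h1, fun x hx => ?_⟩
  by_contra! hcon
  have hxN : x ∉ N := fun h => by
    have := hcon x h
    simp at this
    linarith
  have hPs : P (N.card + 1) := by
    refine ⟨insert x N, Finset.card_insert_of_notMem hxN, ?_, ?_⟩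
    · simpa using ⟨hx, h1⟩
    · intro v hv w hw hvw
      rcases Finset.mem_insert.mp hv with hvx | hv' <;>
        rcases Finset.mem_insert.mp hw with hwx | hw'
      · exact absurd (hvx.trans hwx.symm) hvw
      · exact hvx ▸ hcon w hw'
      · rw [norm_sub_rev]
        exact hwx ▸ hcon v hv'
      · exact h2 v hv' w hw' hvw
  have := Nat.le_findGreatest (hP _ hPs) hPs
  omega

/-- A linear functional bounded by `B` on a `1`-net of the ball of radius `2` has norm at most
`B`. -/
lemma abs_le_of_le_on_net {d : ℕ} {N : Set (EuclideanSpace ℝ (Fin d))}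
    (hN : ∀ x, ‖x‖ ≤ 2 → ∃ v ∈ N, ‖x - v‖ < 1) (f : EuclideanSpace ℝ (Fin d) →ₗ[ℝ] ℝ) {B : ℝ}
    (hB : ∀ v ∈ N, |f v| ≤ B) (x : EuclideanSpace ℝ (Fin d)) : |f x| ≤ B * ‖x‖ := by
  let F : EuclideanSpace ℝ (Fin d) →L[ℝ] ℝ := LinearMap.toContinuousLinearMap f
  have hF : ∀ y, F y = f y := fun y => rfl
  have hB0 : 0 ≤ B := by
    obtain ⟨v, hv, -⟩ := hN 0 (by simp)
    exact (abs_nonneg _).trans (hB v hv)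
  have h1 : ∀ y, ‖y‖ ≤ 2 → |f y| ≤ B + ‖F‖ := fun y hy => by
    obtain ⟨v, hv, hyv⟩ := hN y hy
    have h2 : |f (y - v)| ≤ ‖F‖ * 1 := (F.le_opNorm (y - v)).trans (by gcongr)
    have h3 : f y = f v + f (y - v) := by rw [map_sub]; ring
    rw [h3]
    exact (abs_add_le _ _).trans (by linarith [hB v hv])
  have h2 : ‖F‖ ≤ (B + ‖F‖) / 2 := by
    refine F.opNorm_le_bound (by positivity) fun y => ?_
    rcases eq_or_ne y 0 with rfl | hy
    · simp
    have hy' : 0 < ‖y‖ := norm_pos_iff.mpr hy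
    have h3 := h1 ((2 / ‖y‖) • y) (by
      rw [norm_smul, Real.norm_eq_abs, abs_of_pos (by positivity), div_mul_cancel₀ _ hy'.ne'])
    rw [map_smul, smul_eq_mul, abs_mul, abs_of_pos (by positivity), div_mul_eq_mul_div,
      div_le_iff₀ hy'] at h3
    rw [Real.norm_eq_abs, hF]
    linarith
  calc |f x| ≤ ‖F‖ * ‖x‖ := F.le_opNorm x
    _ ≤ B * ‖x‖ := by gcongr; linarith

/-- A multilinear form bounded by `B` on a product of `1`-nets of the balls of radius `2` is
bounded by `B` on the product of the unit balls. -/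
lemma multilinear_abs_le_of_le_on_net {ι : Type*} [Fintype ι] {d : ι → ℕ}
    {N : ∀ k, Set (EuclideanSpace ℝ (Fin (d k)))}
    (hN : ∀ k x, ‖x‖ ≤ 2 → ∃ v ∈ N k, ‖x - v‖ < 1)
    (M : MultilinearMap ℝ (fun k => EuclideanSpace ℝ (Fin (d k))) ℝ) {B : ℝ}
    (hB : ∀ v, (∀ k, v k ∈ N k) → |M v| ≤ B) (u : ∀ k, EuclideanSpace ℝ (Fin (d k)))
    (hu : ∀ k, ‖u k‖ ≤ 1) : |M u| ≤ B := by
  classical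
  have hB0 : 0 ≤ B := by
    choose v hv _ using fun k => hN k 0 (by simp)
    exact (abs_nonneg _).trans (hB v hv)
  -- the coordinates in `s` range over the unit balls, the others over the nets
  have key : ∀ s : Finset ι, ∀ v : ∀ k, EuclideanSpace ℝ (Fin (d k)), (∀ k ∈ s, ‖v k‖ ≤ 1) →
      (∀ k, k ∉ s → v k ∈ N k) → |M v| ≤ B := by
    intro s
    induction s using Finset.induction_on with
    | empty => exact fun v _ hv => hB v fun k => hv k (Finset.notMem_empty k)
    | insert a s ha ih =>
      intro v hv1 hv2
      have h := abs_le_of_le_on_net (hN a) (M.toLinearMap v a) (B := B) (fun x hx => by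
        refine ih (Function.update v a x) (fun k hk => ?_) fun k hk => ?_
        · rw [Function.update_of_ne (by rintro rfl; exact ha hk)]
          exact hv1 k (Finset.mem_insert_of_mem hk)
        · rcases eq_or_ne k a with rfl | hka
          · simpa using hx
          · rw [Function.update_of_ne hka]
            exact hv2 k (by simp [hka, hk])) (v a)
      rw [MultilinearMap.toLinearMap_apply, Function.update_eq_self] at h
      exact h.trans (mul_le_of_le_one_right hB0 (hv1 a (Finset.mem_insert_self a s)))
  exact key Finset.univ u (fun k _ => hu k) fun k hk => absurd (Finset.mem_univ k) hk

end Net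

/-! ### The spectral norm of the error tensor -/

section Spectral

variable {K T : ℕ} {p : Fin K → ℕ}

/-- The multilinear form on `ℝ^T × ℝ^{p 1} × ⋯ × ℝ^{p K}` whose coefficients are the entries of
`X 1, …, X T`. -/
def errForm (X : Fin T → Tensor p) (g : EuclideanSpace ℝ (Fin T))
    (u : ∀ k, EuclideanSpace ℝ (Fin (p k))) : ℝ :=
  ∑ q : Fin T × (∀ k, Fin (p k)), (g q.1 * ∏ k, u k (q.2 k)) * X q.1 q.2

lemma errForm_abs_le_of_le_on_net {N₀ : Set (EuclideanSpace ℝ (Fin T))}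
    (hN₀ : ∀ x, ‖x‖ ≤ 2 → ∃ v ∈ N₀, ‖x - v‖ < 1) {N : ∀ k, Set (EuclideanSpace ℝ (Fin (p k)))}
    (hN : ∀ k x, ‖x‖ ≤ 2 → ∃ v ∈ N k, ‖x - v‖ < 1) (X : Fin T → Tensor p) {B : ℝ}
    (hB : ∀ g ∈ N₀, ∀ u, (∀ k, u k ∈ N k) → |errForm X g u| ≤ B) (g : EuclideanSpace ℝ (Fin T))
    (u : ∀ k, EuclideanSpace ℝ (Fin (p k))) (hu : ∀ k, ‖u k‖ ≤ 1) :
    |errForm X g u| ≤ B * ‖g‖ := by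
  let f : EuclideanSpace ℝ (Fin T) →ₗ[ℝ] ℝ :=
    { toFun := fun g => errForm X g u
      map_add' := fun x y => by
        simp only [errForm, PiLp.add_apply, add_mul, Finset.sum_add_distrib]
      map_smul' := fun a x => by
        simp only [errForm, PiLp.smul_apply, smul_eq_mul, mul_assoc, Finset.mul_sum,
          RingHom.id_apply] }
  refine abs_le_of_le_on_net hN₀ f (fun h hh => ?_) g
  let M : MultilinearMap ℝ (fun k => EuclideanSpace ℝ (Fin (p k))) ℝ :=
    ∑ q : Fin T × (∀ k, Fin (p k)), (h q.1 * X q.1 q.2) •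
      (MultilinearMap.mkPiAlgebra ℝ (Fin K) ℝ).compLinearMap
        fun k => (EuclideanSpace.proj (q.2 k) : EuclideanSpace ℝ (Fin (p k)) →L[ℝ] ℝ).toLinearMap
  have hM : ∀ v, M v = errForm X h v := fun v => by
    simp only [M, errForm, sum_apply, smul_apply,
      MultilinearMap.compLinearMap_apply, MultilinearMap.mkPiAlgebra_apply, smul_eq_mul]
    refine Finset.sum_congr rfl fun q _ => ?_
    simp
    ring
  have := multilinear_abs_le_of_le_on_net hN M (B := B)
    (fun v hv => by rw [hM]; exact hB h hh v hv) u hu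
  rwa [hM] at this

lemma sum_weight_sq (g : EuclideanSpace ℝ (Fin T)) (u : ∀ k, EuclideanSpace ℝ (Fin (p k))) :
    ∑ q : Fin T × (∀ k, Fin (p k)), (g q.1 * ∏ k, u k (q.2 k)) ^ 2 =
      ‖g‖ ^ 2 * ∏ k, ‖u k‖ ^ 2 := by
  simp only [EuclideanSpace.real_norm_sq_eq, Finset.prod_univ_sum, Fintype.piFinset_univ,
    Fintype.sum_prod_type, Finset.sum_mul_sum, mul_pow, Finset.prod_pow]

/-- The spectral norm of a tensor of independent sub-Gaussian errors exceeds `s` with a probability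
that is controlled by a union bound over a product of nets. -/
lemma measure_errForm_unbounded_le {Ω : Type*} [MeasurableSpace Ω] {μ : Measure Ω}
    [IsProbabilityMeasure μ] {e : Ω → Fin T → Tensor p} {c : NNReal}
    (hindep : iIndepFun (fun (q : Fin T × (∀ k, Fin (p k))) (ω : Ω) => e ω q.1 q.2) μ)
    (hsub : ∀ t i, HasSubgaussianMGF (fun ω => e ω t i) c μ) {s : ℝ} (hs : 0 ≤ s) :
    μ {ω | ¬ ∀ g u, (∀ k, ‖u k‖ ≤ 1) → |errForm (e ω) g u| ≤ s * ‖g‖} ≤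
      ENNReal.ofReal (5 ^ (T + ∑ k, p k) *
        (2 * Real.exp (-s ^ 2 / (2 * (4 ^ (K + 1) * c))))) := by
  classical
  obtain ⟨N₀, hc₀, hb₀, hN₀⟩ := exists_finset_net T
  choose N hc hb hN using fun k => exists_finset_net (p k)
  let S : Finset (EuclideanSpace ℝ (Fin T) × ∀ k, EuclideanSpace ℝ (Fin (p k))) :=
    N₀ ×ˢ Fintype.piFinset N
  have hS : (S.card : ℝ) ≤ 5 ^ (T + ∑ k, p k) := by
    have : S.card ≤ 5 ^ (T + ∑ k, p k) := by
      rw [Finset.card_product, Fintype.card_piFinset, pow_add, ← Finset.prod_pow_eq_pow_sum]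
      exact Nat.mul_le_mul hc₀ (Finset.prod_le_prod' fun k _ => hc k)
    exact_mod_cast this
  have hcover : {ω | ¬ ∀ g u, (∀ k, ‖u k‖ ≤ 1) → |errForm (e ω) g u| ≤ s * ‖g‖} ⊆
      ⋃ v ∈ S, {ω | s < |errForm (e ω) v.1 v.2|} := by
    intro ω hω
    by_contra hcon
    simp only [Set.mem_iUnion, Set.mem_ofPred_eq, not_exists, not_lt] at hcon
    refine hω fun g u hu => errForm_abs_le_of_le_on_net (N₀ := N₀) (N := fun k => N k) hN₀ hN (e ω)
      (fun g hg u hu => hcon (g, u) ?_) g u hu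
    exact Finset.mem_product.mpr ⟨hg, Fintype.mem_piFinset.mpr hu⟩
  have hpt : ∀ v ∈ S, μ {ω | s < |errForm (e ω) v.1 v.2|} ≤
      ENNReal.ofReal (2 * Real.exp (-s ^ 2 / (2 * (4 ^ (K + 1) * c)))) := by
    rintro ⟨g, u⟩ hv
    obtain ⟨hg, hu⟩ := Finset.mem_product.mp hv
    have h4 : ∀ x : ℝ, 0 ≤ x → x ≤ 2 → x ^ 2 ≤ 4 := fun x h0 h2 => by nlinarith
    refine measure_lt_abs_weighted_sum_le hindep (W := 4 ^ (K + 1)) (fun q => hsub q.1 q.2) ?_ hs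
    rw [sum_weight_sq]
    push_cast
    rw [pow_succ' (4 : ℝ) K]
    refine mul_le_mul (h4 _ (norm_nonneg _) (hb₀ g hg)) ?_
      (Finset.prod_nonneg fun _ _ => sq_nonneg _) (by norm_num)
    calc _ ≤ ∏ _k : Fin K, (4 : ℝ) := Finset.prod_le_prod (fun _ _ => sq_nonneg _) fun k _ =>
          h4 _ (norm_nonneg _) (hb k _ (Fintype.mem_piFinset.mp hu k))
      _ = 4 ^ K := by simp
  refine (measure_mono hcover).trans ((measure_biUnion_finset_le S _).trans
    ((Finset.sum_le_sum hpt).trans ?_))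
  rw [Finset.sum_const, nsmul_eq_mul, ← ENNReal.ofReal_natCast,
    ← ENNReal.ofReal_mul (Nat.cast_nonneg _)]
  exact ENNReal.ofReal_le_ofReal (by gcongr)

end Spectral

/-! ### The error of the fitted signal -/

section Signal

lemma orthonormal_col {m n : ℕ} {U : Matrix (Fin m) (Fin n) ℝ} (hU : Uᵀ * U = 1) :
    Orthonormal ℝ fun j => (WithLp.toLp 2 fun i => U i j : EuclideanSpace ℝ (Fin m)) := by
  rw [orthonormal_iff_ite]
  intro i j
  have h := congrFun (congrFun hU j) i
  rw [Matrix.mul_apply, Matrix.one_apply] at h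
  simp only [PiLp.inner_apply, Matrix.transpose_apply, RCLike.inner_apply, conj_trivial] at h ⊢
  rw [h]
  simp [eq_comm]

/-- Two matrices with `n` columns have a common orthonormal basis of at most `2 n` vectors for their
column spaces. -/
lemma exists_common_orthonormal_factor {m n : ℕ} (A B : Matrix (Fin m) (Fin n) ℝ) :
    ∃ q ≤ 2 * n, ∃ Q : Matrix (Fin m) (Fin q) ℝ, Qᵀ * Q = 1 ∧
      ∃ R R' : Matrix (Fin q) (Fin n) ℝ, A = Q * R ∧ B = Q * R' := by
  let w : Fin n ⊕ Fin n → EuclideanSpace ℝ (Fin m) :=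
    Sum.elim (fun j => WithLp.toLp 2 fun i => A i j) fun j => WithLp.toLp 2 fun i => B i j
  let V := Submodule.span ℝ (Set.range w)
  let b := stdOrthonormalBasis ℝ V
  have hw : ∀ j i, w j i = ∑ l, (b l : EuclideanSpace ℝ (Fin m)) i *
      inner ℝ (b l) ⟨w j, Submodule.subset_span ⟨j, rfl⟩⟩ := fun j i => by
    have h := congrArg (fun x : V => (x : EuclideanSpace ℝ (Fin m)) i)
      (b.sum_repr' ⟨w j, Submodule.subset_span ⟨j, rfl⟩⟩)
    simp only [Submodule.coe_sum, Submodule.coe_smul, WithLp.ofLp_sum, Finset.sum_apply,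
      PiLp.smul_apply, smul_eq_mul] at h
    rw [← h]
    exact Finset.sum_congr rfl fun l _ => mul_comm _ _
  refine ⟨Module.finrank ℝ V, ?_, Matrix.of fun i l => (b l : EuclideanSpace ℝ (Fin m)) i, ?_,
    Matrix.of fun l j => inner ℝ (b l) ⟨w (Sum.inl j), Submodule.subset_span ⟨_, rfl⟩⟩,
    Matrix.of fun l j => inner ℝ (b l) ⟨w (Sum.inr j), Submodule.subset_span ⟨_, rfl⟩⟩, ?_, ?_⟩
  · have := finrank_range_le_card (R := ℝ) w
    simpa [two_mul, Set.finrank] using this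
  · ext l l'
    have h := orthonormal_iff_ite.mp b.orthonormal l' l
    rw [Submodule.coe_inner, PiLp.inner_apply] at h
    simp only [RCLike.inner_apply, conj_trivial] at h
    rw [Matrix.mul_apply, Matrix.one_apply]
    simp only [Matrix.transpose_apply, Matrix.of_apply]
    rw [h]
    simp [eq_comm]
  · ext i j
    exact hw (Sum.inl j) i
  · ext i j
    exact hw (Sum.inr j) i

variable {K T : ℕ} {r p : Fin K → ℕ}

lemma norm_le_one_of_transpose_mul_self {m n : ℕ} {Q : Matrix (Fin m) (Fin n) ℝ}
    (hQ : Qᵀ * Q = 1) (j : Fin n) :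
    ‖(WithLp.toLp 2 fun i => Q i j : EuclideanSpace ℝ (Fin m))‖ ≤ 1 :=
  ((orthonormal_col hQ).1 j).le

/-- The pairing of the errors with tensors in a Tucker format splits into `∏ q_k` values of the
error form. -/
lemma sq_sum_mul_tucker_le {q : Fin K → ℕ} {Q : ∀ k, Matrix (Fin (p k)) (Fin (q k)) ℝ}
    (hQ : ∀ k, (Q k)ᵀ * Q k = 1) (X : Fin T → Tensor p) {s : ℝ}
    (hX : ∀ g u, (∀ k, ‖u k‖ ≤ 1) → |errForm X g u| ≤ s * ‖g‖) (G : Fin T → Tensor q) :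
    (∑ t, ∑ i, X t i * tucker (G t) Q i) ^ 2 ≤
      s ^ 2 * ((∏ k, q k : ℕ) * ∑ t, Tensor.frobSq (G t)) := by
  let g : (∀ k, Fin (q k)) → EuclideanSpace ℝ (Fin T) := fun l => WithLp.toLp 2 fun t => G t l
  let u : (∀ k, Fin (q k)) → ∀ k, EuclideanSpace ℝ (Fin (p k)) :=
    fun l k => WithLp.toLp 2 fun i => Q k i (l k)
  have hsplit : ∑ t, ∑ i, X t i * tucker (G t) Q i = ∑ l, errForm X (g l) (u l) := by
    simp only [errForm, tucker, Finset.mul_sum, Fintype.sum_prod_type]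
    conv_rhs => rw [Finset.sum_comm]
    refine Finset.sum_congr rfl fun t _ => ?_
    rw [Finset.sum_comm]
    refine Finset.sum_congr rfl fun l _ => Finset.sum_congr rfl fun i _ => ?_
    simp only [g, u]
    ring
  have hg : ∑ l, ‖g l‖ ^ 2 = ∑ t, Tensor.frobSq (G t) := by
    simp only [g, EuclideanSpace.real_norm_sq_eq, Tensor.frobSq]
    exact Finset.sum_comm
  have h1 : |∑ l, errForm X (g l) (u l)| ≤ s * ∑ l, ‖g l‖ := by
    rw [Finset.mul_sum]
    exact (Finset.abs_sum_le_sum_abs _ _).trans (Finset.sum_le_sum fun l _ =>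
      hX _ _ fun k => norm_le_one_of_transpose_mul_self (hQ k) _)
  have h2 : (∑ l, ‖g l‖) ^ 2 ≤ (∏ k, q k : ℕ) * ∑ l, ‖g l‖ ^ 2 := by
    simpa using sq_sum_le_card_mul_sum_sq (s := Finset.univ) (f := fun l => ‖g l‖)
  rw [hsplit, ← sq_abs, ← hg]
  calc _ ≤ (s * ∑ l, ‖g l‖) ^ 2 := pow_le_pow_left₀ (abs_nonneg _) h1 2
    _ = s ^ 2 * (∑ l, ‖g l‖) ^ 2 := mul_pow _ _ _
    _ ≤ _ := mul_le_mul_of_nonneg_left h2 (sq_nonneg s)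

/-- The basic inequality of least squares, `‖Δ‖² ≤ 2 ⟨E, Δ⟩`, together with the fact that the
difference `Δ` of two signals has mode ranks at most `2 r_k`. -/
lemma sum_frobSq_signal_sub_le {θ θ₀ : Param r p T} {e : Fin T → Tensor p}
    (hls : lsLoss (fun t => θ₀.signal t + e t) θ ≤ lsLoss (fun t => θ₀.signal t + e t) θ₀)
    (hT : 0 < T) {s : ℝ} (he : ∀ g u, (∀ k, ‖u k‖ ≤ 1) → |errForm e g u| ≤ s * ‖g‖) :
    ∑ t, Tensor.frobSq (θ.signal t - θ₀.signal t) ≤ 4 * s ^ 2 * ∏ k, (2 * r k : ℝ) := by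
  -- the coordinates of both signals in a common orthonormal system along each mode
  choose q hq Q hQ R R₀ hR hR₀ using
    fun k => exists_common_orthonormal_factor (θ.loading k) (θ₀.loading k)
  let G : Fin T → Tensor q := fun t => tucker (θ.factor t) R - tucker (θ₀.factor t) R₀
  have hG : ∀ t, θ.signal t - θ₀.signal t = tucker (G t) Q := fun t => by
    simp only [G, tucker_sub, tucker_tucker, ← hR, ← hR₀]
    rfl
  set x := ∑ t, Tensor.frobSq (θ.signal t - θ₀.signal t) with hx
  have hx0 : 0 ≤ x := Finset.sum_nonneg fun _ _ => frobSq_nonneg _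
  have hxG : ∑ t, Tensor.frobSq (G t) = x := by
    simp only [hx, hG, frobSq_tucker hQ]
  have hbasic : x ≤ 2 * ∑ t, ∑ i, e t i * tucker (G t) Q i := by
    have hT' : (0 : ℝ) < 1 / T := by positivity
    have h := le_of_mul_le_mul_left hls hT'
    have h1 : ∑ t, Tensor.frobSq (θ₀.signal t + e t - θ.signal t) =
        ∑ t, Tensor.frobSq (e t) - 2 * ∑ t, ∑ i, e t i * tucker (G t) Q i + x := by
      rw [hx, Finset.mul_sum, ← Finset.sum_sub_distrib, ← Finset.sum_add_distrib]
      refine Finset.sum_congr rfl fun t _ => ?_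
      rw [← hG]
      simp only [Tensor.frobSq, Finset.mul_sum]
      rw [← Finset.sum_sub_distrib, ← Finset.sum_add_distrib]
      refine Finset.sum_congr rfl fun i _ => ?_
      simp only [Pi.add_apply, Pi.sub_apply]
      ring
    simp only [h1, add_sub_cancel_left] at h
    linarith
  have hsq := sq_sum_mul_tucker_le hQ e he G
  rw [hxG] at hsq
  have hqr : ((∏ k, q k : ℕ) : ℝ) ≤ ∏ k, (2 * r k : ℝ) := by
    push_cast
    exact Finset.prod_le_prod (fun _ _ => by positivity) fun k _ => by exact_mod_cast hq k
  rcases hx0.eq_or_lt with h0 | h0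
  · rw [← h0]
    exact mul_nonneg (by positivity) (Finset.prod_nonneg fun _ _ => by positivity)
  · have h2 : x ^ 2 ≤ (2 * ∑ t, ∑ i, e t i * tucker (G t) Q i) ^ 2 :=
      pow_le_pow_left₀ hx0 hbasic 2
    have h3 : x * x ≤ (4 * s ^ 2 * (∏ k, q k : ℕ)) * x := by nlinarith
    exact (le_of_mul_le_mul_right h3 h0).trans (mul_le_mul_of_nonneg_left hqr (by positivity))

end Signal

/-! ### From the signal to the loadings and the factors -/

section Frobenius

attribute [local instance] Matrix.frobeniusNormedAddCommGroup

lemma frobenius_norm_sq {m n : Type*} [Fintype m] [Fintype n] (A : Matrix m n ℝ) :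
    ‖A‖ ^ 2 = ∑ i, ∑ j, A i j ^ 2 := by
  rw [Matrix.frobenius_norm_def, ← Real.sqrt_eq_rpow, Real.sq_sqrt (by positivity)]
  simp

lemma norm_toLp_mulVec_le {m n : Type*} [Fintype m] [Fintype n] (A : Matrix m n ℝ)
    (v : EuclideanSpace ℝ n) : ‖(WithLp.toLp 2 (A *ᵥ v) : EuclideanSpace ℝ m)‖ ≤ ‖A‖ * ‖v‖ := by
  refine le_of_sq_le_sq ?_ (by positivity)
  rw [mul_pow, frobenius_norm_sq, EuclideanSpace.real_norm_sq_eq, EuclideanSpace.real_norm_sq_eq,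
    Finset.sum_mul]
  exact Finset.sum_le_sum fun i _ => Finset.sum_mul_sq_le_sq_mul_sq _ _ _

lemma norm_mul_transpose_sub_le {m n : Type*} [Fintype m] [Fintype n] (A B : Matrix m n ℝ) :
    ‖A * Aᵀ - B * Bᵀ‖ ≤ ‖A - B‖ * (2 * ‖B‖ + ‖A - B‖) := by
  have h : A * Aᵀ - B * Bᵀ = (A - B) * Aᵀ + B * (A - B)ᵀ := by
    rw [Matrix.transpose_sub, Matrix.sub_mul, Matrix.mul_sub]
    abel
  have hA : ‖A‖ ≤ ‖B‖ + ‖A - B‖ := by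
    have := norm_add_le B (A - B)
    rwa [add_sub_cancel] at this
  rw [h]
  refine (norm_add_le _ _).trans ?_
  have h1 := Matrix.frobenius_norm_mul (A - B) Aᵀ
  have h2 := Matrix.frobenius_norm_mul B (A - B)ᵀ
  rw [Matrix.frobenius_norm_transpose] at h1 h2
  nlinarith [mul_le_mul_of_nonneg_left hA (norm_nonneg (A - B))]

variable {K T : ℕ} {r p : Fin K → ℕ}

/-- The mode-`k` second moment matrix depends Lipschitz continuously on the tensors. -/
lemma norm_factorCov_sub_sq_le (X Y : Fin T → Tensor p) (k : Fin K) :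
    ‖factorCov X k - factorCov Y k‖ ^ 2 ≤
      ((1 / (T : ℝ)) * ∑ t, Tensor.frobSq (X t - Y t)) *
        (8 * ((1 / (T : ℝ)) * ∑ t, Tensor.frobSq (Y t)) +
          2 * ((1 / (T : ℝ)) * ∑ t, Tensor.frobSq (X t - Y t))) := by
  obtain ⟨c, hs⟩ : ∃ c : ℝ, c ^ 2 = 1 / (T : ℝ) := ⟨_, Real.sq_sqrt (by positivity)⟩
  -- the unfoldings of all the tensors, side by side
  let S : (Fin T → Tensor p) →
      Matrix (Fin (p k)) (Fin T × ∀ j : {j : Fin K // j ≠ k}, Fin (p j)) ℝ :=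
    fun Z => Matrix.of fun a b => c * unfold k (Z b.1) a b.2
  have hcov : ∀ Z, factorCov Z k = S Z * (S Z)ᵀ := fun Z => by
    ext a b
    simp only [factorCov, Matrix.smul_apply, Matrix.sum_apply, Matrix.mul_apply, smul_eq_mul, S,
      Matrix.of_apply, Matrix.transpose_apply, Fintype.sum_prod_type, Finset.mul_sum, ← hs]
    refine Finset.sum_congr rfl fun t _ => Finset.sum_congr rfl fun _ _ => ?_
    ring
  have hnorm : ∀ Z, ‖S Z‖ ^ 2 = (1 / (T : ℝ)) * ∑ t, Tensor.frobSq (Z t) := fun Z => by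
    rw [frobenius_norm_sq, Finset.mul_sum]
    simp only [frobSq_eq_sum_unfold k, S, Matrix.of_apply, Fintype.sum_prod_type, mul_pow, hs,
      Finset.mul_sum]
    exact Finset.sum_comm
  have hsub : S X - S Y = S fun t => X t - Y t := by
    ext a b
    simp only [S, unfold_sub, Matrix.sub_apply, Matrix.of_apply]
    ring
  rw [hcov, hcov, ← hnorm, ← hnorm, ← hsub]
  refine (pow_le_pow_left₀ (norm_nonneg _) (norm_mul_transpose_sub_le _ _) 2).trans ?_
  rw [mul_pow]
  refine mul_le_mul_of_nonneg_left ?_ (sq_nonneg _)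
  nlinarith [sq_nonneg (2 * ‖S Y‖ - ‖S X - S Y‖)]

lemma specMap_col {m n : ℕ} (U : Matrix (Fin m) (Fin n) ℝ) (lam : Fin n → ℝ)
    (v : EuclideanSpace ℝ (Fin m)) :
    specMap (fun j => (WithLp.toLp 2 fun i => U i j : EuclideanSpace ℝ (Fin m))) lam v =
      WithLp.toLp 2 ((U * Matrix.diagonal lam * Uᵀ) *ᵥ v) := by
  ext i
  rw [← Matrix.mulVec_mulVec, ← Matrix.mulVec_mulVec]
  simp only [specMap, WithLp.ofLp_sum, WithLp.ofLp_smul, Finset.sum_apply, Pi.smul_apply,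
    smul_eq_mul, Matrix.mulVec, dotProduct, Matrix.diagonal_apply, ite_mul, zero_mul,
    Finset.sum_ite_eq, Finset.mem_univ, if_true, PiLp.inner_apply, RCLike.inner_apply,
    conj_trivial, Matrix.transpose_apply]
  refine Finset.sum_congr rfl fun j _ => ?_
  rw [mul_comm (U i j)]
  congr 2
  exact Finset.sum_congr rfl fun _ _ => mul_comm _ _

/-- The cosines of the angles between corresponding columns of the loadings are close to `±1` if
the two signals are close. -/
lemma one_sub_cos_sq_le {U U' : ∀ k, Matrix (Fin (p k)) (Fin (r k)) ℝ}
    (hU : ∀ k, (U k)ᵀ * U k = 1) (hU' : ∀ k, (U' k)ᵀ * U' k = 1) {F F' : Fin T → Tensor r}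
    (k : Fin K) (hF : (factorCov F k).IsDiag) (hF' : (factorCov F' k).IsDiag)
    (hanti : Antitone fun j => factorCov F k j j) (hanti' : Antitone fun j => factorCov F' k j j)
    (hpos' : ∀ j, 0 ≤ factorCov F' k j j) {g : ℝ} (hg : 0 < g)
    (hgap0 : ∀ j, g ≤ factorCov F k j j)
    (hgap : ∀ i j, i ≠ j → g ≤ |factorCov F k i i - factorCov F k j j|) {δ τ : ℝ}
    (hδ : (1 / (T : ℝ)) * ∑ t, Tensor.frobSq (tucker (F' t) U' - tucker (F t) U) ≤ δ)
    (hτ : (1 / (T : ℝ)) * ∑ t, Tensor.frobSq (F t) ≤ τ) (j : Fin (r k)) :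
    1 - (∑ i, U k i j * U' k i j) ^ 2 ≤ 4 * (δ * (8 * τ + 2 * δ)) / g ^ 2 := by
  have hdiag : ∀ (G : Fin T → Tensor r), (factorCov G k).IsDiag →
      Matrix.diagonal (fun j => factorCov G k j j) = factorCov G k := fun G hG => hG.diagonal_diag
  have h := one_sub_inner_sq_le (orthonormal_col (hU k)) (orthonormal_col (hU' k)) hanti hanti'
    (fun j => hg.le.trans (hgap0 j)) hpos' hg hgap0 hgap (fun v => by
      rw [specMap_col, specMap_col, hdiag _ hF, hdiag _ hF', ← factorCov_tucker hU,
        ← factorCov_tucker hU', ← WithLp.toLp_sub, ← Matrix.sub_mulVec]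
      exact norm_toLp_mulVec_le _ v) j
  have hc : inner ℝ (WithLp.toLp 2 fun i => U k i j : EuclideanSpace ℝ (Fin (p k)))
      (WithLp.toLp 2 fun i => U' k i j) = ∑ i, U k i j * U' k i j := by
    simp [PiLp.inner_apply, mul_comm]
  rw [hc] at h
  refine h.trans (div_le_div_of_nonneg_right ?_ (sq_nonneg g))
  refine mul_le_mul_of_nonneg_left ((norm_factorCov_sub_sq_le _ _ k).trans ?_) zero_le_four
  simp only [frobSq_tucker hU]
  have h0 : 0 ≤ (1 / (T : ℝ)) * ∑ t, Tensor.frobSq (tucker (F' t) U' - tucker (F t) U) :=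
    mul_nonneg (by positivity) (Finset.sum_nonneg fun _ _ => frobSq_nonneg _)
  have h1 : 0 ≤ (1 / (T : ℝ)) * ∑ t, Tensor.frobSq (F t) :=
    mul_nonneg (by positivity) (Finset.sum_nonneg fun _ _ => frobSq_nonneg _)
  have h2 := h0.trans hδ
  gcongr

end Frobenius

section Cosines

lemma sum_sq_col_eq_one {m n : ℕ} {U : Matrix (Fin m) (Fin n) ℝ} (hU : Uᵀ * U = 1) (j : Fin n) :
    ∑ i, U i j ^ 2 = 1 := by
  have h := congrFun (congrFun hU j) j
  rw [Matrix.mul_apply, Matrix.one_apply_eq] at h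
  simpa [sq] using h

lemma abs_cos_le_one {m n : ℕ} {U V : Matrix (Fin m) (Fin n) ℝ} (hU : Uᵀ * U = 1)
    (hV : Vᵀ * V = 1) (j : Fin n) : |∑ i, U i j * V i j| ≤ 1 := by
  have h := Finset.sum_mul_sq_le_sq_mul_sq Finset.univ (fun i => U i j) (fun i => V i j)
  rw [sum_sq_col_eq_one hU, sum_sq_col_eq_one hV, one_mul] at h
  exact (sq_le_one_iff_abs_le_one _).mp h

lemma matFrobSq_eq_of_orthonormal {m n : ℕ} {U : Matrix (Fin m) (Fin n) ℝ} (hU : Uᵀ * U = 1) :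
    matFrobSq U = n := by
  rw [matFrobSq, Finset.sum_comm]
  simp [sum_sq_col_eq_one hU]

lemma real_sign_sq_le_one (c : ℝ) : Real.sign c ^ 2 ≤ 1 := by
  rcases Real.sign_apply_eq c with h | h | h <;> simp [h]

lemma real_sign_mul_self (c : ℝ) : Real.sign c * c = |c| := by
  rcases lt_trichotomy c 0 with h | rfl | h
  · simp [Real.sign_of_neg h, abs_of_neg h]
  · simp
  · simp [Real.sign_of_pos h, abs_of_pos h]

/-- The diagonal matrix of the signs of the cosines between corresponding columns. -/
noncomputable def cosSign {m n : ℕ} (U V : Matrix (Fin m) (Fin n) ℝ) : Matrix (Fin n) (Fin n) ℝ :=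
  Matrix.diagonal fun j => Real.sign (∑ i, U i j * V i j)

lemma mul_cosSign_apply {m n : ℕ} (W U V : Matrix (Fin m) (Fin n) ℝ) (i : Fin m) (j : Fin n) :
    (W * cosSign U V) i j = W i j * Real.sign (∑ i, U i j * V i j) := by
  rw [cosSign, Matrix.mul_diagonal]

lemma matFrobSq_sub_mul_cosSign_le {m n : ℕ} {U V : Matrix (Fin m) (Fin n) ℝ} (hU : Uᵀ * U = 1)
    (hV : Vᵀ * V = 1) {η : ℝ} (hη : ∀ j, 1 - (∑ i, U i j * V i j) ^ 2 ≤ η) :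
    matFrobSq (V - U * cosSign U V) ≤ n * (2 * η) := by
  rw [matFrobSq, Finset.sum_comm]
  calc _ ≤ ∑ _j : Fin n, 2 * η := by
        refine Finset.sum_le_sum fun j _ => ?_
        have h := one_sub_two_mul_abs_add_sign_sq_le (abs_cos_le_one hU hV j)
        have h1 : ∑ i, (V - U * cosSign U V) i j ^ 2 =
            1 - 2 * |∑ i, U i j * V i j| + Real.sign (∑ i, U i j * V i j) ^ 2 := by
          rw [← real_sign_mul_self]
          set s := Real.sign (∑ i, U i j * V i j) with hs
          calc _ = ∑ i, V i j ^ 2 - 2 * (s * ∑ i, U i j * V i j) + s ^ 2 * ∑ i, U i j ^ 2 := by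
                rw [Finset.mul_sum, Finset.mul_sum, Finset.mul_sum, ← Finset.sum_sub_distrib,
                  ← Finset.sum_add_distrib]
                refine Finset.sum_congr rfl fun i _ => ?_
                rw [Matrix.sub_apply, mul_cosSign_apply, ← hs]
                ring
            _ = _ := by rw [sum_sq_col_eq_one hU, sum_sq_col_eq_one hV, mul_one]
        rw [h1]
        linarith [hη j]
    _ = n * (2 * η) := by simp

lemma prod_sub_prod_le {ι : Type*} (s : Finset ι) {a b : ι → ℝ} {R : ℝ} (hR : 1 ≤ R)
    (hb : ∀ i, 0 ≤ b i) (hba : ∀ i, b i ≤ a i) (ha : ∀ i, a i ≤ R) :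
    ∏ i ∈ s, a i - ∏ i ∈ s, b i ≤ R ^ s.card * ∑ i ∈ s, (a i - b i) := by
  classical
  induction s using Finset.induction_on with
  | empty => simp
  | insert k s hk ih =>
    rw [Finset.prod_insert hk, Finset.prod_insert hk, Finset.sum_insert hk,
      Finset.card_insert_of_notMem hk]
    have hR0 : 0 ≤ R := zero_le_one.trans hR
    have h1 : ∏ i ∈ s, b i ≤ R ^ s.card := by
      simpa using Finset.prod_le_prod (fun i _ => hb i) fun i (_ : i ∈ s) => (hba i).trans (ha i)
    have h0 : 0 ≤ ∏ i ∈ s, b i := Finset.prod_nonneg fun i _ => hb i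
    have hd : 0 ≤ ∑ i ∈ s, (a i - b i) := Finset.sum_nonneg fun i _ => sub_nonneg.mpr (hba i)
    have hRs : 0 ≤ R ^ s.card := pow_nonneg hR0 _
    have ha0 : 0 ≤ a k := (hb k).trans (hba k)
    have hk0 := sub_nonneg.mpr (hba k)
    calc a k * ∏ i ∈ s, a i - b k * ∏ i ∈ s, b i
        = a k * (∏ i ∈ s, a i - ∏ i ∈ s, b i) + (a k - b k) * ∏ i ∈ s, b i := by ring
      _ ≤ R * (R ^ s.card * ∑ i ∈ s, (a i - b i)) + (a k - b k) * R ^ s.card := by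
          refine add_le_add ?_ (mul_le_mul_of_nonneg_left h1 hk0)
          exact (mul_le_mul_of_nonneg_left ih ha0).trans
            (mul_le_mul_of_nonneg_right (ha k) (mul_nonneg hRs hd))
      _ ≤ R * (R ^ s.card * ∑ i ∈ s, (a i - b i)) + R * ((a k - b k) * R ^ s.card) := by
          exact add_le_add le_rfl (le_mul_of_one_le_left (mul_nonneg hk0 hRs) hR)
      _ = R ^ (s.card + 1) * (a k - b k + ∑ i ∈ s, (a i - b i)) := by ring

variable {K T : ℕ} {r p : Fin K → ℕ}

/-- Closeness of the signals and of the loadings (up to sign) implies closeness of the factors: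
mode products with `U'` are isometric, and `F` with its modes multiplied by the signs becomes
`F ×_k (U'_k S_k)`, which is close to `F ×_k U_k`. -/
lemma sum_frobSq_factor_sub_le {U U' : ∀ k, Matrix (Fin (p k)) (Fin (r k)) ℝ}
    (hU : ∀ k, (U k)ᵀ * U k = 1) (hU' : ∀ k, (U' k)ᵀ * U' k = 1) (F F' : Fin T → Tensor r)
    {R : ℝ} (hR : 1 ≤ R) (hrR : ∀ k, (r k : ℝ) ≤ R) {η : ℝ}
    (hη : ∀ k j, 1 - (∑ i, U k i j * U' k i j) ^ 2 ≤ η) :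
    ∑ t, Tensor.frobSq (F' t - tucker (F t) fun k => cosSign (U k) (U' k)) ≤
      2 * ∑ t, Tensor.frobSq (tucker (F' t) U' - tucker (F t) U) +
        4 * (R ^ K * ∑ k, r k * η) * ∑ t, Tensor.frobSq (F t) := by
  have hsq : ∀ k, matFrobSq (U' k * cosSign (U k) (U' k)) ≤ r k := fun k => by
    rw [← matFrobSq_eq_of_orthonormal (hU' k)]
    refine Finset.sum_le_sum fun i _ => Finset.sum_le_sum fun j _ => ?_
    rw [mul_cosSign_apply, mul_pow]
    exact mul_le_of_le_one_right (sq_nonneg _) (real_sign_sq_le_one _)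
  have hin : ∀ k, ∑ i, ∑ j, U k i j * (U' k * cosSign (U k) (U' k)) i j =
      ∑ j, |∑ i, U k i j * U' k i j| := fun k => by
    rw [Finset.sum_comm]
    refine Finset.sum_congr rfl fun j _ => ?_
    rw [← real_sign_mul_self, Finset.mul_sum]
    refine Finset.sum_congr rfl fun i _ => ?_
    rw [mul_cosSign_apply]
    ring
  have hcos : ∀ k j, |∑ i, U k i j * U' k i j| ≤ 1 := fun k j => abs_cos_le_one (hU k) (hU' k) j
  have hle : ∀ k, ∑ j, |∑ i, U k i j * U' k i j| ≤ r k := fun k => by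
    simpa using Finset.sum_le_sum fun j (_ : j ∈ Finset.univ) => hcos k j
  have hdef : ∀ k, (r k : ℝ) - ∑ j, |∑ i, U k i j * U' k i j| ≤ r k * η := fun k => by
    have h : ∑ j : Fin (r k), (1 - |∑ i, U k i j * U' k i j|) ≤ ∑ _j : Fin (r k), η :=
      Finset.sum_le_sum fun j _ => by
        refine le_trans ?_ (hη k j)
        rw [← sq_abs]
        nlinarith [hcos k j, abs_nonneg (∑ i, U k i j * U' k i j)]
    simpa using h
  have hkron : ∏ k, matFrobSq (U k) + ∏ k, matFrobSq (U' k * cosSign (U k) (U' k)) -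
      2 * ∏ k, ∑ i, ∑ j, U k i j * (U' k * cosSign (U k) (U' k)) i j ≤
      2 * (R ^ K * ∑ k, r k * η) := by
    have h1 : ∏ k, matFrobSq (U' k * cosSign (U k) (U' k)) ≤ ∏ k, (r k : ℝ) :=
      Finset.prod_le_prod
        (fun k _ => Finset.sum_nonneg fun _ _ => Finset.sum_nonneg fun _ _ => sq_nonneg _)
        fun k _ => hsq k
    have h2 := prod_sub_prod_le Finset.univ hR
      (fun k => Finset.sum_nonneg fun j (_ : j ∈ Finset.univ) =>
        abs_nonneg (∑ i, U k i j * U' k i j)) hle hrR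
    have h3 : R ^ K * ∑ k, ((r k : ℝ) - ∑ j, |∑ i, U k i j * U' k i j|) ≤
        R ^ K * ∑ k, r k * η :=
      mul_le_mul_of_nonneg_left (Finset.sum_le_sum fun k _ => hdef k)
        (pow_nonneg (zero_le_one.trans hR) _)
    simp only [Finset.card_univ, Fintype.card_fin] at h2
    simp only [hin, fun k => matFrobSq_eq_of_orthonormal (hU k)]
    linarith
  rw [Finset.mul_sum, Finset.mul_sum, ← Finset.sum_add_distrib]
  refine Finset.sum_le_sum fun t _ => ?_
  have h1 : tucker (F' t - tucker (F t) fun k => cosSign (U k) (U' k)) U' =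
      (tucker (F' t) U' - tucker (F t) U) +
        (tucker (F t) U - tucker (F t) fun k => U' k * cosSign (U k) (U' k)) := by
    rw [tucker_sub, tucker_tucker]
    abel
  rw [← frobSq_tucker hU', h1]
  have h2 := frobSq_tucker_sub_le (F t) U fun k => U' k * cosSign (U k) (U' k)
  have h3 := mul_le_mul_of_nonneg_left hkron (frobSq_nonneg (F t))
  linarith [frobSq_add_le (tucker (F' t) U' - tucker (F t) U)
    (tucker (F t) U - tucker (F t) fun k => U' k * cosSign (U k) (U' k))]

end Cosines

section Normalised

/-- A matrix divided by the square root of its number of rows. For the loadings of an element of the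
parameter space, the columns become orthonormal. -/
noncomputable def normalise {m n : ℕ} (A : Matrix (Fin m) (Fin n) ℝ) : Matrix (Fin m) (Fin n) ℝ :=
  (Real.sqrt m)⁻¹ • A

lemma sqrt_smul_normalise {m n : ℕ} (hm : 0 < m) (A : Matrix (Fin m) (Fin n) ℝ) :
    Real.sqrt m • normalise A = A := by
  have : Real.sqrt m ≠ 0 := (Real.sqrt_pos.mpr (by exact_mod_cast hm)).ne'
  rw [normalise, smul_smul, mul_inv_cancel₀ this, one_smul]

lemma inv_sqrt_mul_self (m : ℕ) : (Real.sqrt m)⁻¹ * (Real.sqrt m)⁻¹ = 1 / (m : ℝ) := by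
  rw [← mul_inv, Real.mul_self_sqrt (Nat.cast_nonneg m), one_div]

lemma normalise_transpose_mul_self {m n : ℕ} {A : Matrix (Fin m) (Fin n) ℝ}
    (hA : (1 / (m : ℝ)) • (Aᵀ * A) = 1) : (normalise A)ᵀ * normalise A = 1 := by
  rw [normalise, Matrix.transpose_smul, Matrix.smul_mul, Matrix.mul_smul, smul_smul,
    inv_sqrt_mul_self, hA]

lemma signMatrix_eq_cosSign {m n : ℕ} (A B : Matrix (Fin m) (Fin n) ℝ) :
    signMatrix A B = cosSign (normalise A) (normalise B) := by
  rw [signMatrix, cosSign]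
  congr 1
  ext j
  congr 1
  rw [Matrix.mul_apply, Finset.sum_div]
  refine Finset.sum_congr rfl fun i _ => ?_
  simp only [normalise, Matrix.smul_apply, smul_eq_mul, Matrix.transpose_apply]
  rw [mul_mul_mul_comm, inv_sqrt_mul_self]
  ring

lemma matFrobSq_smul {m n : ℕ} (c : ℝ) (A : Matrix (Fin m) (Fin n) ℝ) :
    matFrobSq (c • A) = c ^ 2 * matFrobSq A := by
  simp [matFrobSq, mul_pow, Finset.mul_sum]

variable {K T : ℕ} {r p : Fin K → ℕ}

lemma signal_eq_smul (hp : ∀ k, 0 < p k) (θ : Param r p T) (t : Fin T) :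
    θ.signal t = (∏ k, Real.sqrt (p k)) • tucker (θ.factor t) fun k => normalise (θ.loading k) := by
  rw [← tucker_smul]
  simp only [sqrt_smul_normalise (hp _)]
  rfl

/-- Two parameter values with close signals are close up to signs. -/
lemma loading_and_factor_le {𝒜 : ∀ k, Set (Fin (r k) → ℝ)} {ℱ : Set (Tensor r)}
    {θ θ₀ : Param r p T} (hθ : θ ∈ paramSpace 𝒜 ℱ p T) (hθ₀ : θ₀ ∈ paramSpace 𝒜 ℱ p T)
    (hp : ∀ k, 0 < p k) {g : ℝ} (hg : 0 < g) (hgap0 : ∀ k j, g ≤ factorCov θ₀.factor k j j)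
    (hgap : ∀ k i j, i ≠ j → g ≤ |factorCov θ₀.factor k i i - factorCov θ₀.factor k j j|)
    {δ τ R : ℝ} (hδ : (1 / (T : ℝ)) * ∑ t, Tensor.frobSq (θ.signal t - θ₀.signal t) ≤
      (∏ k, (p k : ℝ)) * δ) (hτ : (1 / (T : ℝ)) * ∑ t, Tensor.frobSq (θ₀.factor t) ≤ τ)
    (hR : 1 ≤ R) (hrR : ∀ k, (r k : ℝ) ≤ R) :
    (∀ k, (1 / (p k : ℝ)) * matFrobSq (θ.loading k -
      θ₀.loading k * signMatrix (θ₀.loading k) (θ.loading k)) ≤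
        r k * (2 * (4 * (δ * (8 * τ + 2 * δ)) / g ^ 2))) ∧
    (1 / (T : ℝ)) * ∑ t, Tensor.frobSq (θ.factor t - tucker (θ₀.factor t)
      fun k => signMatrix (θ₀.loading k) (θ.loading k)) ≤
        2 * δ + 4 * (R ^ K * ∑ k, r k * (4 * (δ * (8 * τ + 2 * δ)) / g ^ 2)) * τ := by
  have hU : ∀ k, (normalise (θ.loading k))ᵀ * normalise (θ.loading k) = 1 :=
    fun k => normalise_transpose_mul_self (hθ.2.1 k)
  have hU₀ : ∀ k, (normalise (θ₀.loading k))ᵀ * normalise (θ₀.loading k) = 1 :=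
    fun k => normalise_transpose_mul_self (hθ₀.2.1 k)
  have hP : 0 < ∏ k, (p k : ℝ) := Finset.prod_pos fun k _ => by exact_mod_cast hp k
  have hδ' : (1 / (T : ℝ)) * ∑ t, Tensor.frobSq
      (tucker (θ.factor t) (fun k => normalise (θ.loading k)) -
        tucker (θ₀.factor t) fun k => normalise (θ₀.loading k)) ≤ δ := by
    simp only [signal_eq_smul hp, ← smul_sub, frobSq_smul, ← Finset.prod_pow,
      Real.sq_sqrt (Nat.cast_nonneg _), ← Finset.mul_sum] at hδ
    rw [mul_left_comm] at hδ
    exact le_of_mul_le_mul_left hδ hP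
  have hη := fun k => one_sub_cos_sq_le hU₀ hU k (hθ₀.2.2.2 k).1 (hθ.2.2.2 k).1 (hθ₀.2.2.2 k).2.2
    (hθ.2.2.2 k).2.2 (fun j => ((hθ.2.2.2 k).2.1 j).le) hg (hgap0 k) (hgap k) hδ' hτ
  have hδ0 : 0 ≤ δ := le_trans
    (mul_nonneg (by positivity) (Finset.sum_nonneg fun _ _ => frobSq_nonneg _)) hδ'
  have hτ0 : 0 ≤ τ := le_trans
    (mul_nonneg (by positivity) (Finset.sum_nonneg fun _ _ => frobSq_nonneg _)) hτ
  have hR0 : 0 ≤ R := zero_le_one.trans hR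
  constructor
  · intro k
    refine le_of_eq_of_le ?_ (matFrobSq_sub_mul_cosSign_le (hU₀ k) (hU k) (hη k))
    rw [signMatrix_eq_cosSign]
    have h : normalise (θ.loading k) - normalise (θ₀.loading k) *
        cosSign (normalise (θ₀.loading k)) (normalise (θ.loading k)) =
        (Real.sqrt (p k))⁻¹ • (θ.loading k - θ₀.loading k *
          cosSign (normalise (θ₀.loading k)) (normalise (θ.loading k))) := by
      rw [smul_sub, ← Matrix.smul_mul]
      rfl
    rw [h, matFrobSq_smul, sq, inv_sqrt_mul_self]
  · simp only [signMatrix_eq_cosSign]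
    have h := sum_frobSq_factor_sub_le hU₀ hU θ₀.factor θ.factor hR hrR hη
    calc _ ≤ (1 / (T : ℝ)) * _ := mul_le_mul_of_nonneg_left h (by positivity)
      _ = 2 * ((1 / (T : ℝ)) * ∑ t, Tensor.frobSq
          (tucker (θ.factor t) (fun k => normalise (θ.loading k)) -
            tucker (θ₀.factor t) fun k => normalise (θ₀.loading k))) +
          4 * (R ^ K * ∑ k, r k * (4 * (δ * (8 * τ + 2 * δ)) / g ^ 2)) *
            ((1 / (T : ℝ)) * ∑ t, Tensor.frobSq (θ₀.factor t)) := by ring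
      _ ≤ _ := by gcongr

end Normalised

/-! ### Rates -/

section Rates

variable {K : ℕ}

lemma rateL_pos [NeZero K] {p : Fin K → ℕ} {T : ℕ} (hT : 0 < T) (hp : ∀ k, 0 < p k) :
    0 < rateL p T := by
  refine lt_min (Finset.prod_pos fun k _ => hp k) ?_
  rw [Finset.lt_inf'_iff]
  exact fun k _ => Nat.mul_pos hT (Finset.prod_pos fun j _ => hp j)

/-- The number of free directions, relative to the number of observations, is at most
`(K + 1) / L`. -/
lemma dim_div_le [NeZero K] {p : Fin K → ℕ} {T : ℕ} (hT : 0 < T) (hp : ∀ k, 0 < p k) :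
    (1 / (T : ℝ)) * ((T + ∑ k, p k : ℕ) : ℝ) ≤
      (∏ k, (p k : ℝ)) * ((K + 1) * (1 / (rateL p T : ℝ))) := by
  have hL : (0 : ℝ) < rateL p T := by exact_mod_cast rateL_pos hT hp
  have hT' : (0 : ℝ) < T := by exact_mod_cast hT
  have h1 : (rateL p T : ℝ) ≤ ∏ k, (p k : ℝ) := by
    exact_mod_cast (min_le_left _ _ : rateL p T ≤ ∏ k, p k)
  have h2 : ∀ k, (rateL p T : ℝ) * p k ≤ T * ∏ k, (p k : ℝ) := fun k => by
    have h : rateL p T ≤ T * sizeExcept p k :=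
      (min_le_right _ _).trans (Finset.inf'_le _ (Finset.mem_univ k))
    have h3 : rateL p T * p k ≤ T * ∏ k, p k := by
      rw [← Finset.mul_prod_erase Finset.univ p (Finset.mem_univ k)]
      calc _ ≤ T * sizeExcept p k * p k := Nat.mul_le_mul_right _ h
        _ = _ := by rw [sizeExcept]; ring
    exact_mod_cast h3
  have h4 : (rateL p T : ℝ) * (T + ∑ k, (p k : ℝ)) ≤ (K + 1) * (T * ∏ k, (p k : ℝ)) := by
    rw [mul_add, Finset.mul_sum, add_mul, one_mul, add_comm]
    refine add_le_add ?_ (by nlinarith)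
    calc _ ≤ ∑ _k : Fin K, (T : ℝ) * ∏ k, (p k : ℝ) := Finset.sum_le_sum fun k _ => h2 k
      _ = _ := by simp
  push_cast
  rw [one_div_mul_eq_div, div_le_iff₀ hT', mul_one_div, mul_div_assoc', div_mul_eq_mul_div,
    le_div_iff₀ hL]
  linarith

lemma exists_pos_forall_le {α : Type*} [Finite α] (f : α → ℝ) (hf : ∀ a, 0 < f a) :
    ∃ g > 0, ∀ a, g ≤ f a := by
  cases isEmpty_or_nonempty α
  · exact ⟨1, one_pos, fun a => isEmptyElim a⟩
  · obtain ⟨a, ha⟩ := Finite.exists_min f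
    exact ⟨f a, hf a, ha⟩

/-- The eigenvalues of the second moment matrices are eventually separated from each other and from
`0`, and their sums are bounded. -/
lemma eventually_gap {r : Fin K → ℕ} (Sig : ∀ k, Matrix (Fin (r k)) (Fin (r k)) ℝ)
    (hpos : ∀ k j, 0 < Sig k j j) (hanti : ∀ k, StrictAnti fun j => Sig k j j)
    {M : ℕ → ∀ k, Matrix (Fin (r k)) (Fin (r k)) ℝ}
    (hlim : ∀ k, Tendsto (fun n => M n k) atTop (𝓝 (Sig k))) :
    ∃ g > 0, ∃ τ, 0 ≤ τ ∧ ∀ᶠ n in atTop, (∀ k j, g ≤ M n k j j) ∧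
      (∀ k i j, i ≠ j → g ≤ |M n k i i - M n k j j|) ∧ ∀ k, (M n k).trace ≤ τ := by
  obtain ⟨g₁, hg₁, h₁⟩ := exists_pos_forall_le (fun a : Σ k, Fin (r k) => Sig a.1 a.2 a.2)
    fun a => hpos _ _
  obtain ⟨g₂, hg₂, h₂⟩ := exists_pos_forall_le
    (fun a : Σ k, {b : Fin (r k) × Fin (r k) // b.1 ≠ b.2} =>
      |Sig a.1 a.2.1.1 a.2.1.1 - Sig a.1 a.2.1.2 a.2.1.2|)
    fun a => abs_pos.mpr (sub_ne_zero.mpr ((hanti a.1).injective.ne a.2.2))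
  have hentry : ∀ k i j, Tendsto (fun n => M n k i j) atTop (𝓝 (Sig k i j)) := fun k i j =>
    ((continuous_apply j).tendsto _).comp (((continuous_apply i).tendsto _).comp (hlim k))
  have htrace : ∀ k, Tendsto (fun n => (M n k).trace) atTop (𝓝 (Sig k).trace) := fun k =>
    tendsto_finsetSum _ fun j _ => hentry k j j
  have htr0 : ∀ k, 0 ≤ (Sig k).trace := fun k => Finset.sum_nonneg fun j _ => (hpos k j).le
  refine ⟨min g₁ g₂ / 2, by positivity, ∑ k, (Sig k).trace + 1,
    add_nonneg (Finset.sum_nonneg fun k _ => htr0 k) zero_le_one, ?_⟩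
  have hlt : min g₁ g₂ / 2 < min g₁ g₂ := half_lt_self (by positivity)
  refine Filter.Eventually.and ?_ (Filter.Eventually.and ?_ ?_)
  · simp only [eventually_all]
    intro k j
    exact ((hentry k j j).eventually_const_lt
      (hlt.trans_le ((min_le_left _ _).trans (h₁ ⟨k, j⟩)))).mono fun _ h => h.le
  · simp only [eventually_all]
    intro k i j hij
    exact (((hentry k i i).sub (hentry k j j)).abs.eventually_const_lt
      (hlt.trans_le ((min_le_right _ _).trans (h₂ ⟨k, ⟨(i, j), hij⟩⟩)))).mono fun _ h => h.le
  · simp only [eventually_all]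
    intro k
    have : (Sig k).trace < ∑ k, (Sig k).trace + 1 :=
      lt_of_le_of_lt (Finset.single_le_sum (fun k _ => htr0 k) (Finset.mem_univ k)) (lt_add_one _)
    exact ((htrace k).eventually_lt_const this).mono fun _ h => h.le

/-- The union bound over nets of cardinality `5 ^ D` beats the Gaussian tail `exp (-2 D)`. -/
lemma tendsto_net_bound {D : ℕ → ℕ} (hD : Tendsto D atTop atTop) :
    Tendsto (fun n => (5 : ℝ) ^ D n * (2 * Real.exp (-(2 * D n)))) atTop (𝓝 0) := by
  have h5 : 5 * Real.exp (-2) < 1 := by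
    have h1 := Real.exp_one_gt_d9
    have h2 : Real.exp 2 = Real.exp 1 * Real.exp 1 := by rw [← Real.exp_add]; norm_num
    rw [Real.exp_neg, ← div_eq_mul_inv, div_lt_one (Real.exp_pos 2), h2]
    nlinarith
  have h := ((tendsto_pow_atTop_nhds_zero_of_lt_one (by positivity) h5).comp hD).const_mul 2
  rw [mul_zero] at h
  refine h.congr fun n => ?_
  rw [Function.comp_apply, mul_pow, ← Real.exp_nat_mul]
  ring_nf

/-- To bound a nonnegative quantity in probability it suffices to bound it outside exceptional
events of vanishing probability. -/
lemma isBigOP_of_eventually {Ω : Type*} [MeasurableSpace Ω] {μ : Measure Ω} {Y : ℕ → Ω → ℝ}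
    {a : ℕ → ℝ} {bad : ℕ → Set Ω} (hbad : Tendsto (fun n => μ (bad n)) atTop (𝓝 0)) {C : ℝ}
    (ha : ∀ n, 0 ≤ a n) (hY0 : ∀ n ω, 0 ≤ Y n ω)
    (hY : ∀ᶠ n in atTop, ∀ ω, ω ∉ bad n → Y n ω ≤ C * a n) : IsBigOP μ Y a := by
  intro ε hε
  refine ⟨max C 1, by positivity, ?_⟩
  filter_upwards [hY, hbad.eventually_le_const (ENNReal.ofReal_pos.mpr hε)] with n hn hb
  refine (measure_mono fun ω hω => ?_).trans hb
  by_contra hcon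
  have h1 : max C 1 * |a n| < |Y n ω| := hω
  rw [abs_of_nonneg (ha n), abs_of_nonneg (hY0 n ω)] at h1
  exact absurd (hn ω hcon) (not_le.mpr
    ((mul_le_mul_of_nonneg_right (le_max_left C 1) (ha n)).trans_lt h1))

end Rates

end TensorFactor

theorem mainTheorem3
    {Ω : Type*} [MeasurableSpace Ω] (μ : Measure Ω) [IsProbabilityMeasure μ]
    -- order of the tensors and numbers of factors (fixed)
    {K : ℕ} [NeZero K] (r : Fin K → ℕ)
    -- sample sizes, with `min {T, p₁, …, p_K} → ∞`
    (T : ℕ → ℕ) (p : ℕ → Fin K → ℕ)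
    (hT : Tendsto T atTop atTop) (hp : ∀ k, Tendsto (fun n => p n k) atTop atTop)
    -- the parameter space and the true parameter
    (𝒜 : ∀ k, Set (Fin (r k) → ℝ)) (ℱ : Set (Tensor r))
    (h𝒜 : ∀ k, IsClosed (𝒜 k)) (hℱ : IsClosed ℱ)
    (θ₀ : ∀ n, Param r (p n) (T n))
    (hθ₀ : ∀ n, θ₀ n ∈ paramSpace 𝒜 ℱ (p n) (T n))
    -- pervasive loadings
    (hstrong : ∃ c : Fin K → ℝ, (∀ k, 0 < c k) ∧
      ∀ n k, Real.sqrt (matFrobSq ((θ₀ n).loading k)) = c k * Real.sqrt (p n k))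
    -- limits of the second moment matrices of the (nonrandom) factors
    (Sig : ∀ k, Matrix (Fin (r k)) (Fin (r k)) ℝ)
    (hSig_diag : ∀ k, (Sig k).IsDiag) (hSig_pos : ∀ k j, 0 < Sig k j j)
    (hSig_anti : ∀ k, StrictAnti fun j => Sig k j j)
    (hSig_lim : ∀ k, Tendsto (fun n => factorCov (θ₀ n).factor k) atTop (𝓝 (Sig k)))
    -- the errors: independent, centred, sub-Gaussian, nondegenerate
    (e : ∀ n, Ω → Fin (T n) → Tensor (p n))
    (he_meas : ∀ n t i, Measurable fun ω => e n ω t i)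
    (he_indep : ∀ n, iIndepFun
      (fun (q : Fin (T n) × (∀ k, Fin (p n k))) (ω : Ω) => e n ω q.1 q.2) μ)
    (he_mean : ∀ n t i, ∫ ω, e n ω t i ∂μ = 0)
    (he_subG : ∃ ν : ℝ, 0 < ν ∧ ∀ n t i, ∀ d : ℕ, 1 ≤ d →
      Integrable (fun ω => |e n ω t i| ^ (2 * d)) μ ∧
      ∫ ω, |e n ω t i| ^ (2 * d) ∂μ ≤
        (Nat.factorial (2 * d) : ℝ) / (2 ^ d * (Nat.factorial d : ℝ)) * ν ^ (2 * d))
    (he_pos : ∀ n t, ∀ᵐ ω ∂μ, 0 < Real.sqrt (Tensor.frobSq (e n ω t)))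
    -- a least-squares estimator based on `X_t = F_{0t} ×₁ A₀₁ ⋯ ×_K A₀_K + E_t`
    (θhat : ∀ n, Ω → Param r (p n) (T n))
    (hθhat : ∀ n, ∀ᵐ ω ∂μ, IsLeastSquares (paramSpace 𝒜 ℱ (p n) (T n))
      (fun t => (θ₀ n).signal t + e n ω t) (θhat n ω)) :
    (∀ k, IsBigOP μ
      (fun n ω => (1 / (p n k : ℝ)) * matFrobSq ((θhat n ω).loading k -
        (θ₀ n).loading k * signMatrix ((θ₀ n).loading k) ((θhat n ω).loading k)))
      (fun n => 1 / (rateL (p n) (T n) : ℝ))) ∧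
    IsBigOP μ
      (fun n ω => (1 / (T n : ℝ)) * ∑ t, Tensor.frobSq ((θhat n ω).factor t -
        tucker ((θ₀ n).factor t)
          (fun k => signMatrix ((θ₀ n).loading k) ((θhat n ω).loading k))))
      (fun n => 1 / (rateL (p n) (T n) : ℝ)) := by
  classical
  obtain ⟨ν, hν, hmom⟩ := he_subG
  obtain ⟨g, hg, τ, hτ0, hev⟩ := eventually_gap Sig hSig_pos hSig_anti hSig_lim
  set c : NNReal := 4 * Real.toNNReal (ν ^ 2)
  have hc : 0 < (4 : ℝ) ^ (K + 1) * c := by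
    have : 0 < Real.toNNReal (ν ^ 2) := Real.toNNReal_pos.mpr (by positivity)
    have : 0 < c := mul_pos (by norm_num) this
    positivity
  let D : ℕ → ℕ := fun n => T n + ∑ k, p n k
  have hD : Tendsto D atTop atTop := tendsto_atTop_mono (fun n => Nat.le_add_right _ _) hT
  -- the level of the spectral norm, for which the union bound reads `5 ^ D * 2 exp (-2 D)`
  let s : ℕ → ℝ := fun n => Real.sqrt (4 * (4 ^ (K + 1) * c) * D n)
  have hs : ∀ n, s n ^ 2 = 4 * (4 ^ (K + 1) * c) * D n := fun n => Real.sq_sqrt (by positivity)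
  let bad : ℕ → Set Ω := fun n =>
    {ω | ¬ ∀ g u, (∀ k, ‖u k‖ ≤ 1) → |errForm (e n ω) g u| ≤ s n * ‖g‖} ∪
      {ω | ¬ IsLeastSquares (paramSpace 𝒜 ℱ (p n) (T n)) (fun t => (θ₀ n).signal t + e n ω t)
        (θhat n ω)}
  have hbad : Tendsto (fun n => μ (bad n)) atTop (𝓝 0) := by
    have h := ENNReal.tendsto_ofReal (tendsto_net_bound hD)
    rw [ENNReal.ofReal_zero] at h
    refine tendsto_of_tendsto_of_tendsto_of_le_of_le tendsto_const_nhds h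
      (fun _ => zero_le) fun n => ?_
    refine (measure_union_le _ _).trans ?_
    rw [ae_iff.mp (hθhat n), add_zero]
    refine (measure_errForm_unbounded_le (he_indep n) (fun t i =>
      hasSubgaussianMGF_of_even_moments (he_meas n t i) (he_mean n t i)
        (hmom n t i)) (Real.sqrt_nonneg _)).trans (le_of_eq ?_)
    change ENNReal.ofReal (5 ^ D n * (2 * Real.exp (-s n ^ 2 / (2 * (4 ^ (K + 1) * c))))) = _
    rw [hs]
    congr 4
    rw [div_eq_iff (mul_pos two_pos hc).ne']
    ring
  let Cδ : ℝ := 4 * (4 * (4 ^ (K + 1) * c)) * (∏ k, (2 * r k : ℝ)) * (K + 1)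
  have hr0 : 0 ≤ ∏ k, (2 * r k : ℝ) := Finset.prod_nonneg fun _ _ => by positivity
  have hCδ : 0 ≤ Cδ := by positivity
  let Cη : ℝ := 4 * (Cδ * (8 * τ + 2 * Cδ)) / g ^ 2
  let R : ℝ := 1 + ∑ k, (r k : ℝ)
  have hR : 1 ≤ R := le_add_of_nonneg_right (by positivity)
  have hrR : ∀ k, (r k : ℝ) ≤ R := fun k =>
    (Finset.single_le_sum (fun j _ => Nat.cast_nonneg (r j)) (Finset.mem_univ k)).trans
      (le_add_of_nonneg_left zero_le_one)
  have hR0 : 0 ≤ R := zero_le_one.trans hR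
  have hmain : ∀ᶠ n in atTop, ∀ ω, ω ∉ bad n →
      (∀ k, (1 / (p n k : ℝ)) * matFrobSq ((θhat n ω).loading k -
        (θ₀ n).loading k * signMatrix ((θ₀ n).loading k) ((θhat n ω).loading k)) ≤
          r k * (2 * Cη) * (1 / (rateL (p n) (T n) : ℝ))) ∧
      (1 / (T n : ℝ)) * ∑ t, Tensor.frobSq ((θhat n ω).factor t - tucker ((θ₀ n).factor t)
          (fun k => signMatrix ((θ₀ n).loading k) ((θhat n ω).loading k))) ≤
        (2 * Cδ + 4 * (R ^ K * ∑ k, r k * Cη) * τ) * (1 / (rateL (p n) (T n) : ℝ)) := by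
    filter_upwards [hev, hT.eventually_gt_atTop 0,
      eventually_all.mpr fun k => (hp k).eventually_gt_atTop 0] with n hn hTn hpn ω hω
    obtain ⟨hgap0, hgap, htr⟩ := hn
    simp only [bad, Set.mem_union, Set.mem_ofPred_eq, not_or, not_not] at hω
    obtain ⟨hspec, hmem, hls⟩ := hω
    have hL : (1 : ℝ) ≤ rateL (p n) (T n) := by exact_mod_cast rateL_pos hTn hpn
    set x : ℝ := 1 / (rateL (p n) (T n) : ℝ) with hx
    have hx0 : 0 ≤ x := by positivity
    have hx1 : x ≤ 1 := by
      rw [hx, div_le_one (by linarith)]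
      exact hL
    have hδ : (1 / (T n : ℝ)) * ∑ t, Tensor.frobSq ((θhat n ω).signal t - (θ₀ n).signal t) ≤
        (∏ k, (p n k : ℝ)) * (Cδ * x) := by
      have h1 := sum_frobSq_signal_sub_le (hls _ (hθ₀ n)) hTn hspec
      rw [hs] at h1
      have h2 := mul_le_mul_of_nonneg_left (dim_div_le hTn hpn)
        (by positivity : 0 ≤ 4 * (4 * (4 ^ (K + 1) * (c : ℝ))) * ∏ k, (2 * r k : ℝ))
      calc _ ≤ (1 / (T n : ℝ)) * _ := mul_le_mul_of_nonneg_left h1 (by positivity)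
        _ = 4 * (4 * (4 ^ (K + 1) * (c : ℝ))) * (∏ k, (2 * r k : ℝ)) *
            (1 / (T n : ℝ) * (D n : ℝ)) := by ring
        _ ≤ _ := h2
        _ = _ := by simp only [Cδ, ← hx]; ring
    have hτ : (1 / (T n : ℝ)) * ∑ t, Tensor.frobSq ((θ₀ n).factor t) ≤ τ := by
      rw [← trace_factorCov _ (0 : Fin K)]
      exact htr 0
    obtain ⟨h1, h2⟩ := loading_and_factor_le hmem (hθ₀ n) hpn hg hgap0 hgap hδ hτ hR hrR
    have hη : 4 * (Cδ * x * (8 * τ + 2 * (Cδ * x))) / g ^ 2 ≤ Cη * x := by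
      have h3 : Cδ * x ≤ Cδ := mul_le_of_le_one_right hCδ hx1
      calc _ ≤ 4 * (Cδ * x * (8 * τ + 2 * Cδ)) / g ^ 2 := by gcongr
        _ = Cη * x := by simp only [Cη]; ring
    refine ⟨fun k => (h1 k).trans ?_, h2.trans ?_⟩
    · calc _ ≤ r k * (2 * (Cη * x)) := by gcongr
        _ = _ := by ring
    · calc _ ≤ 2 * (Cδ * x) + 4 * (R ^ K * ∑ k, r k * (Cη * x)) * τ := by gcongr
        _ = _ := by
          simp only [← mul_assoc, ← Finset.sum_mul]
          ring
  refine ⟨fun k => isBigOP_of_eventually hbad (C := r k * (2 * Cη)) (fun n => by positivity)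
      (fun n ω => mul_nonneg (by positivity)
        (Finset.sum_nonneg fun _ _ => Finset.sum_nonneg fun _ _ => sq_nonneg _))
      (hmain.mono fun n hn ω hω => (hn ω hω).1 k),
    isBigOP_of_eventually hbad (C := 2 * Cδ + 4 * (R ^ K * ∑ k, r k * Cη) * τ)
      (fun n => by positivity)
      (fun n ω => mul_nonneg (by positivity) (Finset.sum_nonneg fun _ _ => frobSq_nonneg _))
      (hmain.mono fun n hn ω hω => (hn ω hω).2)⟩
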